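/- Let $d\ge 0$ and let $\rho:\mathrm{SL}_2(\mathbb Z)\to \mathrm{GL}_d(\mathbb C)$ be a representation with $\rho(-1)=1$ (i.e. a matrix representation of $\mathrm{PSL}_2(\mathbb Z)$) such that $T=\rho\begin{pmatrix}1&1\\0&1\end{pmatrix}$ is diagonal of finite order. Write $\mathbf H$ for the upper half-plane and $q^r=e^{2\pi i r\tau}$. **Definitions.** An *exponent matrix* is a rational diagonal matrix $\Lambda$ with $e^{2\pi i\Lambda}=T$ (one exists; it is determined up to adding an integral diagonal matrix). $\mathcal M(\rho)$ is the complex vector space of holomorphic maps $\mathbb X:\mathbf H\to\mathbb C^d$ with $\mathbb X\big(\tfrac{a\tau+b}{c\tau+d'}\big)=\rho\begin{pmatrix}a&b\\c&d'\end{pmatrix}\mathbb X(\tau)$ for all $\begin{pmatrix}a&b\\c&d'\end{pmatrix}\in\mathrm{SL}_2(\mathbb Z)$ that have only finite order poles at the cusps: in the expansion $q^{-\Lambda}\mathbb X(\tau)=\sum_{n\in\mathbb Z}\mathbb X[n]q^n$ only finitely many $\mathbb X[n]$ with $n<0$ are nonzero (this does not depend on the choice of $\Lambda$). For a given $\Lambda$,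 the principal part map $\mathcal P_\Lambda$ sends $\mathbb X\in\mathcal M(\rho)$ to $\sum_{n<0}\mathbb X[n]q^n$, a finite sum with coefficients in $\mathbb C^d$. Let $J=E_4^3/\Delta-744=q^{-1}+\sum_{n\ge1}c(n)q^n$ and $\mathcal E=E_{10}/\Delta=q^{-1}-240-\cdots$, where $E_k$ is the Eisenstein series of weight $k$ with constant term $1$ and $\Delta=q\prod_{n\ge1}(1-q^n)^{24}$. **Theorem.** 1. $\mathcal M(\rho)$ is stable under multiplication by $J$, and it is a free $\mathbb C[J]$-module of rank $d$. 2. There is an exponent matrix $\Lambda$ for which $\mathcal P_\Lambda$ is a bijection from $\mathcal M(\rho)$ onto the space of all finite principal parts $\sum_{n<0}v_nq^n$, $v_n\in\mathbb C^d$. 3. Let $\Lambda$ be any exponent matrix for which $\mathcal P_\Lambda$ is bijective. Then there are unique $\mathbb X^{(\xi;n)}\in\mathcal M(\rho)$, $1\le\xi\le d$, $n\ge1$ (the canonical basis vectors) with $\big[\mathcal P_\Lambda\mathbb X^{(\xi;n)}\big]_\eta=q^{-n}\delta_{\xi\eta}$, and they form a basis of the complex vector space $\mathcal M(\rho)$.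 With $\mathcal X^{(\xi;m)}_\eta=\mathbb X^{(\xi;m)}[0]_\eta$ they satisfy, for all $\xi$ and $m\ge1$, $$\mathbb X^{(\xi;m+1)}=J\,\mathbb X^{(\xi;m)}-\sum_{n=1}^{m-1}c(n)\,\mathbb X^{(\xi;m-n)}-\sum_{\eta}\mathcal X^{(\xi;m)}_\eta\,\mathbb X^{(\eta;1)} .$$ Let $\Xi(\tau)_{\xi\eta}=\big[\mathbb X^{(\eta;1)}(\tau)\big]_\xi$ (the fundamental matrix) and $\mathcal X_{\xi\eta}=\mathcal X^{(\eta;1)}_\xi$. Then: - the columns of $\Xi$ are linearly independent over $\mathbb C[J]$ and span $\mathcal M(\rho)$ over $\mathbb C[J]$, and $\det\Xi$ is not identically zero; - for all $\tau\in\mathbf H$, $$\frac{\mathcal E(\tau)}{2\pi i}\frac{d\Xi}{d\tau}=\Xi(\tau)\big\{(J(\tau)-240)(\Lambda-1)+\mathcal X+\Lambda\mathcal X-\mathcal X\Lambda\big\},$$ so that $\frac1{2\pi i}\frac{d\Xi}{d\tau}=\Xi(\tau)D(\tau)$ with $D(\tau)=\frac1{\mathcal E(\tau)}\big\{(J(\tau)-240)(\Lambda-1)+\mathcal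 X+\Lambda\mathcal X-\mathcal X\Lambda\big\}$ at every $\tau$ with $\mathcal E(\tau)\ne0$; - $q^{1-\Lambda_{\xi\xi}}\,\Xi(\tau)_{\xi\eta}=\delta_{\xi\eta}+O(q)$ as $\tau\to i\infty$, for all $\xi,\eta$; - $\Xi\big(\tfrac{a\tau+b}{c\tau+d'}\big)=\rho\begin{pmatrix}a&b\\c&d'\end{pmatrix}\Xi(\tau)$ for all $\begin{pmatrix}a&b\\c&d'\end{pmatrix}\in\mathrm{SL}_2(\mathbb Z)$ and $\tau\in\mathbf H$. -/

import Mathlib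

open Complex Matrix UpperHalfPlane
open scoped Real MatrixGroups Manifold Asymptotics

noncomputable section

namespace VVMF

/-- `q ^ r = exp (2 π i r τ)` as a function of `τ` in the upper half-plane. -/
def qPow (r : ℂ) (τ : ℍ) : ℂ := cexp (2 * π * Complex.I * r * τ)

/-- The Laurent series `∑ a n * q ^ n` converges to `f` on the whole upper half-plane. -/
def HasQSeries (f : ℍ → ℂ) (a : ℤ → ℂ) : Prop :=
  ∀ τ : ℍ, HasSum (fun n : ℤ => a n * qPow n τ) (f τ)

open Classical in
/-- The coefficients of the Laurent expansion of `f` in powers of `q`. They are unique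
(`HasQSeries.qCoeff_eq`); the value is zero if there is no expansion. -/
def qCoeff (f : ℍ → ℂ) : ℤ → ℂ :=
  if h : ∃ a, HasQSeries f a then h.choose else 0

theorem HasQSeries.eq_zero {a : ℤ → ℂ} (h : HasQSeries 0 a) : a = 0 := by
  have : Fact (0 < (1 : ℝ)) := ⟨one_pos⟩
  set b : ℤ → ℂ := fun n => a n * Real.exp (-(2 * π * n)) with hb
  have key : ∀ (x : ℝ) (n : ℤ), a n * qPow n ⟨x + Complex.I, by simp⟩
      = b n * fourier (T := 1) n (x : AddCircle (1 : ℝ)) := by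
    intro x n
    rw [hb, fourier_coe_apply, qPow]
    simp only [mul_assoc]
    congr 1
    rw [Complex.ofReal_exp, ← Complex.exp_add]
    congr 1
    push_cast
    linear_combination (2 * (π : ℂ) * n) * Complex.I_mul_I
  have hsum : Summable (fun n => ‖b n‖) := by
    have := (h ⟨((0 : ℝ) : ℂ) + Complex.I, by simp⟩).summable.norm
    refine this.congr fun n => ?_
    rw [key]
    simp
  have hF : Summable (fun n => b n • (fourier n : C(AddCircle (1 : ℝ), ℂ))) := by
    refine Summable.of_norm ?_
    simpa [norm_smul, fourier_norm] using hsum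
  have hF0 : HasSum (fun n => b n • (fourier n : C(AddCircle (1 : ℝ), ℂ))) 0 := by
    convert hF.hasSum
    ext t
    induction t using QuotientAddGroup.induction_on with
    | H x =>
      have h1 := hF.hasSum.mapL (ContinuousMap.evalCLM ℂ (x : AddCircle (1 : ℝ)))
      have h2 := h ⟨(x : ℂ) + Complex.I, by simp⟩
      simp only [key] at h2
      exact h2.unique (by simpa using h1)
  have hL := hF0.mapL (ContinuousMap.toLp (E := ℂ) 2 (AddCircle.haarAddCircle (T := 1)) ℂ)
  funext m
  have hm := hL.mapL (innerSL ℂ (fourierLp (T := 1) 2 m))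
  have horth := orthonormal_iff_ite.mp (orthonormal_fourier (T := 1))
  have hbm : b m = 0 := by
    have hs : HasSum (fun n : ℤ => if n = m then b m else 0) 0 := by
      have e : (fun n : ℤ => if n = m then b m else 0) = fun n : ℤ =>
          innerSL ℂ (fourierLp (T := 1) 2 m)
            (ContinuousMap.toLp (E := ℂ) 2 (AddCircle.haarAddCircle (T := 1)) ℂ
              (b n • (fourier n : C(AddCircle (1 : ℝ), ℂ)))) := by
        funext n
        have := horth m n
        simp only [map_smul, innerSL_apply_apply]
        change _ = b n • inner ℂ (fourierLp (T := 1) 2 m) (fourierLp (T := 1) 2 n)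
        rw [this]
        by_cases hnm : n = m
        · subst hnm; simp
        · simp [hnm, Ne.symm hnm]
      rw [e]
      simpa using hm
    exact (hasSum_ite_eq m (b m)).unique hs
  have := mul_eq_zero.mp hbm
  simpa [Real.exp_ne_zero] using this

theorem HasQSeries.add {f g : ℍ → ℂ} {a b : ℤ → ℂ} (hf : HasQSeries f a) (hg : HasQSeries g b) :
    HasQSeries (f + g) (a + b) := fun τ => by
  simpa [add_mul] using (hf τ).add (hg τ)

theorem HasQSeries.smul {f : ℍ → ℂ} {a : ℤ → ℂ} (c : ℂ) (hf : HasQSeries f a) :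
    HasQSeries (c • f) (c • a) := fun τ => by
  simpa [mul_assoc] using (hf τ).mul_left c

theorem HasQSeries.qCoeff_eq {f : ℍ → ℂ} {a : ℤ → ℂ} (hf : HasQSeries f a) : qCoeff f = a := by
  have hex : ∃ a, HasQSeries f a := ⟨a, hf⟩
  have h1 : HasQSeries f (qCoeff f) := by
    rw [qCoeff, dif_pos hex]
    exact hex.choose_spec
  have h2 : HasQSeries 0 (qCoeff f + (-1 : ℂ) • a) := by
    have := h1.add (hf.smul (-1))
    simpa using this
  have := h2.eq_zero
  simpa [add_neg_eq_zero] using this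

theorem HasQSeries.zero : HasQSeries 0 0 := fun τ => by simp

/-- `f` has a Laurent expansion in `q` with only finitely many negative powers. -/
def HasFinitePole (f : ℍ → ℂ) : Prop :=
  ∃ a : ℤ → ℂ, HasQSeries f a ∧ {n : ℤ | n < 0 ∧ a n ≠ 0}.Finite

theorem HasFinitePole.add {f g : ℍ → ℂ} (hf : HasFinitePole f) (hg : HasFinitePole g) :
    HasFinitePole (f + g) := by
  obtain ⟨a, ha, ha'⟩ := hf
  obtain ⟨b, hb, hb'⟩ := hg
  refine ⟨a + b, ha.add hb, (ha'.union hb').subset ?_⟩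
  rintro n ⟨hn, h⟩
  by_cases h0 : a n = 0
  · exact Or.inr ⟨hn, by simpa [h0] using h⟩
  · exact Or.inl ⟨hn, h0⟩

theorem HasFinitePole.smul {f : ℍ → ℂ} (c : ℂ) (hf : HasFinitePole f) :
    HasFinitePole (c • f) := by
  obtain ⟨a, ha, ha'⟩ := hf
  refine ⟨c • a, ha.smul c, ha'.subset ?_⟩
  rintro n ⟨hn, h⟩
  exact ⟨hn, fun h0 => h (by simp [h0])⟩

theorem HasFinitePole.zero : HasFinitePole 0 := ⟨0, HasQSeries.zero, by simp⟩

/-- Multiplying by an integral power of `q` does not affect finiteness of the pole. -/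
theorem HasFinitePole.qPow_mul {f : ℍ → ℂ} (hf : HasFinitePole f) (k : ℤ) :
    HasFinitePole (fun τ => qPow k τ * f τ) := by
  obtain ⟨a, ha, ha'⟩ := hf
  refine ⟨fun n => a (n - k), fun τ => ?_, ?_⟩
  · have h := (ha τ).mul_left (qPow k τ)
    rw [← (Equiv.subRight k).hasSum_iff] at h
    have e : ∀ n : ℤ, a (n - k) * qPow n τ = qPow k τ * (a (n - k) * qPow ((n - k : ℤ) : ℂ) τ) := by
      intro n
      have e' : qPow n τ = qPow k τ * qPow ((n - k : ℤ) : ℂ) τ := by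
        simp only [qPow]
        rw [← Complex.exp_add]
        congr 1
        push_cast
        ring
      rw [e']
      ring
    simp only [e]
    exact h
  · refine ((ha'.union (Set.finite_Icc 0 (-k))).image (fun n => n + k)).subset ?_
    rintro n ⟨hn, h⟩
    refine ⟨n - k, ?_, by simp⟩
    by_cases h0 : n - k < 0
    · exact Or.inl ⟨h0, h⟩
    · exact Or.inr ⟨by lia, by lia⟩

/-- `Λ` is (the diagonal of) an exponent matrix of `ρ`: `ρ (1 1; 0 1) = exp (2 π i Λ)`. -/
def IsExponent {d : ℕ} (ρ : SL(2, ℤ) →* GL (Fin d) ℂ) (Λ : Fin d → ℚ) : Prop :=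
  (ρ ModularGroup.T : Matrix (Fin d) (Fin d) ℂ) =
    Matrix.diagonal fun ξ => cexp (2 * π * Complex.I * (Λ ξ : ℂ))

/-- The `ξ`-th component of `q ^ (-Λ) X`. -/
def twist {d : ℕ} (Λ : Fin d → ℚ) (X : ℍ → Fin d → ℂ) (ξ : Fin d) : ℍ → ℂ :=
  fun τ => qPow (-(Λ ξ : ℂ)) τ * X τ ξ

theorem twist_add {d : ℕ} (Λ : Fin d → ℚ) (X Y : ℍ → Fin d → ℂ) (ξ : Fin d) :
    twist Λ (X + Y) ξ = twist Λ X ξ + twist Λ Y ξ := by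
  funext τ; simp [twist, mul_add]

theorem twist_smul {d : ℕ} (Λ : Fin d → ℚ) (c : ℂ) (X : ℍ → Fin d → ℂ) (ξ : Fin d) :
    twist Λ (c • X) ξ = c • twist Λ X ξ := by
  funext τ; simp [twist, mul_left_comm]

theorem twist_zero {d : ℕ} (Λ : Fin d → ℚ) (ξ : Fin d) : twist Λ 0 ξ = 0 := by
  funext τ; simp [twist]

/-- An exponent matrix exists when `T` is diagonal of finite order. -/
theorem exists_isExponent {d : ℕ} (ρ : SL(2, ℤ) →* GL (Fin d) ℂ)
    (hdiag : (ρ ModularGroup.T : Matrix (Fin d) (Fin d) ℂ).IsDiag)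
    (hfin : IsOfFinOrder (ρ ModularGroup.T)) : ∃ Λ, IsExponent ρ Λ := by
  obtain ⟨n, hn, hpow⟩ := isOfFinOrder_iff_pow_eq_one.mp hfin
  have hD := hdiag.diagonal_diag
  have h1 : ∀ ξ, (ρ ModularGroup.T : Matrix (Fin d) (Fin d) ℂ) ξ ξ ^ n = 1 := by
    intro ξ
    have h2 := congrArg (fun g : GL (Fin d) ℂ => (g : Matrix (Fin d) (Fin d) ℂ)) hpow
    simp only [Units.val_pow_eq_pow_val, Units.val_one] at h2
    rw [← hD, Matrix.diagonal_pow] at h2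
    have := congrFun (congrFun h2 ξ) ξ
    simpa using this
  have h3 : ∀ ξ, ∃ r : ℚ, cexp (2 * π * Complex.I * (r : ℂ)) =
      (ρ ModularGroup.T : Matrix (Fin d) (Fin d) ℂ) ξ ξ := by
    intro ξ
    have : NeZero n := ⟨hn.ne'⟩
    obtain ⟨i, -, hi⟩ := (Complex.mem_rootsOfUnity n (Units.ofPowEqOne _ n (h1 ξ) hn.ne')).mp
      (by rw [_root_.mem_rootsOfUnity]; ext; simp)
    refine ⟨(i : ℚ) / n, ?_⟩
    simpa using hi
  choose Λ hΛ using h3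
  refine ⟨Λ, ?_⟩
  rw [IsExponent, ← hD]
  simp [hΛ, Matrix.diag]

/-- `X` has only finite order poles at the cusps: for an exponent matrix `Λ` of `ρ`, every
component of `q ^ (-Λ) X` has a Laurent expansion in `q` with finite principal part. The choice
of `Λ` is immaterial, see `hasFinitePoles_iff`. -/
def HasFinitePoles {d : ℕ} (ρ : SL(2, ℤ) →* GL (Fin d) ℂ) (X : ℍ → Fin d → ℂ) : Prop :=
  ∀ Λ, IsExponent ρ Λ → ∀ ξ, HasFinitePole (twist Λ X ξ)

theorem hasFinitePoles_iff {d : ℕ} {ρ : SL(2, ℤ) →* GL (Fin d) ℂ} {Λ : Fin d → ℚ}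
    (hΛ : IsExponent ρ Λ) (X : ℍ → Fin d → ℂ) :
    HasFinitePoles ρ X ↔ ∀ ξ, HasFinitePole (twist Λ X ξ) := by
  refine ⟨fun h => h Λ hΛ, fun h Λ' hΛ' ξ => ?_⟩
  have h1 := congrFun (congrFun (hΛ.symm.trans hΛ') ξ) ξ
  simp only [Matrix.diagonal_apply_eq] at h1
  obtain ⟨k, hk⟩ := Complex.exp_eq_exp_iff_exists_int.mp h1
  have h2 : (Λ ξ : ℂ) = Λ' ξ + k := by
    have h0 : (2 * π * Complex.I : ℂ) ≠ 0 := Complex.two_pi_I_ne_zero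
    apply mul_left_cancel₀ h0
    rw [hk]; ring
  convert (h ξ).qPow_mul k using 1
  funext τ
  simp only [twist, qPow]
  rw [← mul_assoc, ← Complex.exp_add]
  congr 2
  rw [h2]; ring

/-- The space `M(ρ)` of vector-valued modular functions for `ρ`. -/
def modFun {d : ℕ} (ρ : SL(2, ℤ) →* GL (Fin d) ℂ) : Submodule ℂ (ℍ → Fin d → ℂ) where
  carrier := {X | MDifferentiable 𝓘(ℂ) 𝓘(ℂ, Fin d → ℂ) X ∧
    (∀ (γ : SL(2, ℤ)) (τ : ℍ), X (γ • τ) = (ρ γ : Matrix (Fin d) (Fin d) ℂ) *ᵥ X τ) ∧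
    HasFinitePoles ρ X}
  add_mem' := by
    rintro X Y ⟨h1, h2, h3⟩ ⟨h1', h2', h3'⟩
    refine ⟨h1.add h1', fun γ τ => ?_, fun Λ hΛ ξ => ?_⟩
    · rw [Pi.add_apply, h2, h2', Pi.add_apply, Matrix.mulVec_add]
    · rw [twist_add]
      exact (h3 Λ hΛ ξ).add (h3' Λ hΛ ξ)
  zero_mem' := by
    refine ⟨mdifferentiable_const, fun γ τ => by simp, fun Λ hΛ ξ => ?_⟩
    rw [twist_zero]
    exact HasFinitePole.zero
  smul_mem' := by
    rintro c X ⟨h1, h2, h3⟩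
    refine ⟨h1.const_smul c, fun γ τ => ?_, fun Λ hΛ ξ => ?_⟩
    · rw [Pi.smul_apply, h2, Pi.smul_apply, Matrix.mulVec_smul]
    · rw [twist_smul]
      exact (h3 Λ hΛ ξ).smul c

/-- The vector coefficient `X[n]` in the expansion `q ^ (-Λ) X = ∑ X[n] q ^ n`. -/
def vecCoeff {d : ℕ} (Λ : Fin d → ℚ) (X : ℍ → Fin d → ℂ) (n : ℤ) : Fin d → ℂ :=
  fun ξ => qCoeff (twist Λ X ξ) n

/-- The expansion `q ^ (-Λ) X = ∑ X[n] q ^ n` of an element of `M(ρ)`. -/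
theorem hasQSeries_of_mem {d : ℕ} {ρ : SL(2, ℤ) →* GL (Fin d) ℂ} {Λ : Fin d → ℚ}
    (hΛ : IsExponent ρ Λ) {X : ℍ → Fin d → ℂ} (hX : X ∈ modFun ρ) (ξ : Fin d) :
    HasQSeries (twist Λ X ξ) (fun n => vecCoeff Λ X n ξ) := by
  obtain ⟨a, ha, -⟩ := hX.2.2 Λ hΛ ξ
  have : (fun n => vecCoeff Λ X n ξ) = a := ha.qCoeff_eq
  rwa [this]

theorem vecCoeff_support_finite {d : ℕ} {ρ : SL(2, ℤ) →* GL (Fin d) ℂ} {Λ : Fin d → ℚ}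
    (hΛ : IsExponent ρ Λ) {X : ℍ → Fin d → ℂ} (hX : X ∈ modFun ρ) :
    (Function.support fun n : ℕ+ => vecCoeff Λ X (-(n : ℤ))).Finite := by
  have h1 : ∀ ξ, {n : ℤ | n < 0 ∧ vecCoeff Λ X n ξ ≠ 0}.Finite := by
    intro ξ
    obtain ⟨a, ha, hfin⟩ := hX.2.2 Λ hΛ ξ
    have : (fun n => vecCoeff Λ X n ξ) = a := ha.qCoeff_eq
    rwa [← this] at hfin
  refine ((Set.finite_iUnion h1).preimage (f := fun n : ℕ+ => -(n : ℤ)) ?_).subset ?_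
  · intro m _ n _ h
    simpa using h
  · intro n hn
    obtain ⟨ξ, hξ⟩ := Function.ne_iff.mp hn
    exact Set.mem_iUnion.mpr ⟨ξ, by simp, hξ⟩

/-- The principal part map. A principal part `∑_{n<0} X[n] q ^ n` is recorded as the finitely
supported family whose `n`-th member, `n > 0`, is the coefficient of `q ^ (-n)`. -/
def principalPart {d : ℕ} (ρ : SL(2, ℤ) →* GL (Fin d) ℂ) (Λ : Fin d → ℚ) (hΛ : IsExponent ρ Λ) :
    modFun ρ →ₗ[ℂ] (ℕ+ →₀ (Fin d → ℂ)) where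
  toFun X := Finsupp.ofSupportFinite (fun n => vecCoeff Λ X (-(n : ℤ)))
    (vecCoeff_support_finite hΛ X.2)
  map_add' X Y := by
    ext n ξ
    have h := (hasQSeries_of_mem hΛ X.2 ξ).add (hasQSeries_of_mem hΛ Y.2 ξ)
    rw [← twist_add] at h
    exact congrFun h.qCoeff_eq (-(n : ℤ))
  map_smul' c X := by
    ext n ξ
    have h := (hasQSeries_of_mem hΛ X.2 ξ).smul c
    rw [← twist_smul] at h
    exact congrFun h.qCoeff_eq (-(n : ℤ))

/-- The Hauptmodul `J = q⁻¹ + 196884 q + ⋯`. -/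
def hauptmodul (τ : ℍ) : ℂ :=
  ModularForm.E₄ τ ^ 3 / ModularForm.discriminant τ - 744

/-- The coefficients of `J = q⁻¹ + ∑_{n ≥ 1} c(n) q ^ n`. -/
def jCoeff (n : ℤ) : ℂ := qCoeff hauptmodul n

/-- The polynomial algebra `ℂ[J]`, acting on `ℂ ^ d`-valued functions by pointwise
multiplication. -/
abbrev CJ : Subalgebra ℂ (ℍ → ℂ) := Algebra.adjoin ℂ {hauptmodul}

/-- The quotient `E₁₀ / Δ = q⁻¹ - 240 - 141444 q - ⋯`. -/
def calE (τ : ℍ) : ℂ :=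
  ModularForm.E (k := 10) (by norm_num) τ / ModularForm.discriminant τ

/-- The elements of `M(ρ)` with principal part `q ^ (-n) e_ξ`. -/
def IsCanonicalBasis {d : ℕ} {ρ : SL(2, ℤ) →* GL (Fin d) ℂ} {Λ : Fin d → ℚ}
    (hΛ : IsExponent ρ Λ) (B : Fin d → ℕ+ → modFun ρ) : Prop :=
  ∀ ξ n, principalPart ρ Λ hΛ (B ξ n) = Finsupp.single n (Pi.single ξ 1)

/-- The fundamental matrix, whose `η`-th column is the canonical basis vector with principal
part `q⁻¹ e_η`. -/
def fundamentalMatrix {d : ℕ} {ρ : SL(2, ℤ) →* GL (Fin d) ℂ} (B : Fin d → ℕ+ → modFun ρ)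
    (τ : ℍ) : Matrix (Fin d) (Fin d) ℂ :=
  Matrix.of fun ξ η => (B η 1 : ℍ → Fin d → ℂ) τ ξ

/-- The characteristic matrix: its `η`-th column is the constant part of the canonical basis
vector with principal part `q⁻¹ e_η`. -/
def characteristicMatrix {d : ℕ} {ρ : SL(2, ℤ) →* GL (Fin d) ℂ} (Λ : Fin d → ℚ)
    (B : Fin d → ℕ+ → modFun ρ) : Matrix (Fin d) (Fin d) ℂ :=
  Matrix.of fun ξ η => vecCoeff Λ (B η 1) 0 ξ

/-- Entrywise `(1 / 2 π i) d / dτ`. -/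
def qDeriv {d : ℕ} (F : ℍ → Matrix (Fin d) (Fin d) ℂ) (τ : ℍ) : Matrix (Fin d) (Fin d) ℂ :=
  Matrix.of fun ξ η => Derivative.normalizedDerivOfComplex (fun z => F z ξ η) τ

/-- The matrix `(J - 240) (Λ - 1) + 𝒳 + [Λ, 𝒳]`. -/
def compatNumerator {d : ℕ} (Λ : Fin d → ℚ) (𝒳 : Matrix (Fin d) (Fin d) ℂ) (τ : ℍ) :
    Matrix (Fin d) (Fin d) ℂ :=
  let L : Matrix (Fin d) (Fin d) ℂ := Matrix.diagonal fun ξ => (Λ ξ : ℂ)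
  (hauptmodul τ - 240) • (L - 1) + 𝒳 + (L * 𝒳 - 𝒳 * L)

/-- The coefficient matrix of the compatibility equation. -/
def compatD {d : ℕ} (Λ : Fin d → ℚ) (𝒳 : Matrix (Fin d) (Fin d) ℂ) (τ : ℍ) :
    Matrix (Fin d) (Fin d) ℂ :=
  (calE τ)⁻¹ • compatNumerator Λ 𝒳 τ

end VVMF

end

/-! Elements of `modFun ρ` are handled through Laurent series in q that converge absolutely on the
whole half-plane, so products, derivatives and coefficient comparison are all termwise. The heart of
the matter is a single exponent Λ with bijective principal part map.

Surjectivity for some Λ comes from Poincaré series. As T acts by a unitary diagonal matrix, Euclid's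
algorithm on the bottom row shows that ρ(γ) grows at most like a power of the lower left entry
(`exists_norm_mulVec_le_pow`). Poincaré series of large weight therefore converge, and dividing by a
power of Δ returns to weight 0 (`exists_poincare_expansion`, `exists_vecCoeff_eq_single`).
Prescribed leading terms yield all principal parts by triangularity
(`surjective_principalPart_of_vecCoeff_eq_single`).

The kernel is controlled by duality. The contragredient also has a surjective principal part map,
and X ⬝ Y is a scalar modular function of level one, hence zero once it vanishes at the cusp.
Testing X against every Y with one prescribed pole kills its coefficients in turn
(`eq_zero_of_dual_surjective`), so the kernel is finite dimensional. A nonzero kernel contains an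
element with nonzero constant term (`exists_vecCoeff_zero_ne`). Raising the corresponding entry of Λ
by 1 turns that constant term into a pole, which preserves surjectivity and shrinks the kernel
(`exists_surjective_ker_lt`). Induction on the dimension ends at a bijective Λ.

For bijective Λ an identity in `modFun ρ` holds as soon as both sides have the same principal part.
This gives the recurrence, and it gives the differential equation because (E₁₀/Δ) d/dτ preserves
weight 0. The recurrence makes the vectors with a simple pole generate over ℂ[J], and comparing top
degrees in J makes them independent. Finally q^(1-Λ) Ξ → 1 at the cusp forces det Ξ ≠ 0. -/

noncomputable section

namespace VVMF

open Filter Topology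

section

/-! ### Powers of `q` -/

theorem qPow_zero (τ : ℍ) : qPow 0 τ = 1 := by simp [qPow]

theorem qPow_add (r s : ℂ) (τ : ℍ) : qPow (r + s) τ = qPow r τ * qPow s τ := by
  simp only [qPow]
  rw [← Complex.exp_add]
  congr 1
  ring

theorem qPow_neg_mul_self (r : ℂ) (τ : ℍ) : qPow (-r) τ * qPow r τ = 1 := by
  rw [← qPow_add, neg_add_cancel, qPow_zero]

theorem norm_qPow (r : ℝ) (τ : ℍ) : ‖qPow r τ‖ = Real.exp (-(2 * π * r * τ.im)) := by
  rw [qPow, Complex.norm_exp]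
  congr 1
  simp [Complex.mul_re, Complex.mul_im]

theorem qPow_natCast (n : ℕ) (τ : ℍ) : qPow n τ = Function.Periodic.qParam 1 τ ^ n := by
  rw [qPow, Function.Periodic.qParam, ← Complex.exp_nat_mul]
  congr 1
  push_cast
  ring

theorem qPow_vadd_one (r : ℂ) (τ : ℍ) :
    qPow r ((1 : ℝ) +ᵥ τ) = cexp (2 * π * Complex.I * r) * qPow r τ := by
  simp only [qPow, UpperHalfPlane.coe_vadd]
  rw [← Complex.exp_add]
  congr 1
  push_cast
  ring

theorem qPow_intCast_vadd_one (n : ℤ) (τ : ℍ) : qPow n ((1 : ℝ) +ᵥ τ) = qPow n τ := by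
  rw [qPow_vadd_one, mul_comm _ (n : ℂ), Complex.exp_int_mul_two_pi_mul_I, one_mul]

theorem mdifferentiable_qPow (r : ℂ) : MDifferentiable 𝓘(ℂ) 𝓘(ℂ) (qPow r) := by
  rw [UpperHalfPlane.mdifferentiable_iff]
  have : DifferentiableOn ℂ (fun z : ℂ => cexp (2 * π * Complex.I * r * z))
      upperHalfPlaneSet := by fun_prop
  refine this.congr fun z hz => ?_
  simp [qPow, Function.comp_apply, ofComplex_apply_of_im_pos hz]

/-! ### Laurent expansions in `q` -/

theorem HasQSeries.neg {f : ℍ → ℂ} {a : ℤ → ℂ} (hf : HasQSeries f a) : HasQSeries (-f) (-a) := by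
  simpa using hf.smul (-1)

theorem HasQSeries.sub {f g : ℍ → ℂ} {a b : ℤ → ℂ} (hf : HasQSeries f a) (hg : HasQSeries g b) :
    HasQSeries (f - g) (a - b) := by
  simpa [sub_eq_add_neg] using hf.add hg.neg

theorem HasQSeries.sum {ι : Type*} {s : Finset ι} {f : ι → ℍ → ℂ} {a : ι → ℤ → ℂ}
    (h : ∀ i ∈ s, HasQSeries (f i) (a i)) : HasQSeries (∑ i ∈ s, f i) (∑ i ∈ s, a i) := by
  classical
  induction s using Finset.induction_on with
  | empty => simpa using HasQSeries.zero
  | insert i s hi ih =>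
    rw [Finset.sum_insert hi, Finset.sum_insert hi]
    exact (h i (by simp)).add (ih fun j hj => h j (by simp [hj]))

theorem HasQSeries.qPow_mul {f : ℍ → ℂ} {a : ℤ → ℂ} (hf : HasQSeries f a) (k : ℤ) :
    HasQSeries (fun τ => qPow k τ * f τ) (fun n => a (n - k)) := fun τ => by
  have h := (hf τ).mul_left (qPow k τ)
  rw [← (Equiv.subRight k).hasSum_iff] at h
  refine h.congr_fun fun n => ?_
  have e : qPow n τ = qPow k τ * qPow ((n - k : ℤ) : ℂ) τ := by
    rw [← qPow_add]
    congr 1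
    push_cast
    ring
  simp only [Function.comp_apply, Equiv.subRight_apply]
  rw [e]
  ring

theorem HasQSeries.of_qPow_mul {f : ℍ → ℂ} {a : ℤ → ℂ} {k : ℤ}
    (h : HasQSeries (fun τ => qPow k τ * f τ) a) : HasQSeries f (fun n => a (n + k)) := by
  have := h.qPow_mul (-k)
  convert this using 2 with τ n
  · rw [← mul_assoc]
    push_cast
    rw [qPow_neg_mul_self, one_mul]
  · simp

theorem hasQSeries_const (c : ℂ) : HasQSeries (fun _ => c) (Pi.single 0 c) := fun τ => by
  convert hasSum_ite_eq (0 : ℤ) c using 2 with n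
  rcases eq_or_ne n 0 with rfl | hn
  · simp [qPow_zero]
  · simp [hn]

/-- The change of variables `(k, m) ↦ (m, k - m)`. -/
def convEquiv : ℤ × ℤ ≃ ℤ × ℤ where
  toFun p := (p.2, p.1 - p.2)
  invFun p := (p.1 + p.2, p.1)
  left_inv p := by simp
  right_inv p := by simp

/-- In ℂ summability is absolute, so the double series of products may be summed in any order. -/
theorem hasSum_mul_of_complete {a b : ℤ → ℂ} {s t : ℂ} (ha : HasSum a s) (hb : HasSum b t) :
    HasSum (fun x : ℤ × ℤ => a x.1 * b x.2) (s * t) :=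
  ha.mul hb (summable_mul_of_summable_norm ha.summable.norm hb.summable.norm)

/-- Convolution product of two Laurent series with poles of order at most `-M` and `-N`. -/
theorem HasQSeries.mul {f g : ℍ → ℂ} {a b : ℤ → ℂ} {M N : ℤ} (hf : HasQSeries f a)
    (hg : HasQSeries g b) (ha : ∀ n < M, a n = 0) (hb : ∀ n < N, b n = 0) :
    HasQSeries (f * g) (fun k => ∑ m ∈ Finset.Icc M (k - N), a m * b (k - m)) := fun τ => by
  have h := hasSum_mul_of_complete (hf τ) (hg τ)
  rw [← convEquiv.hasSum_iff] at h
  refine HasSum.prod_fiberwise h fun k => ?_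
  have hterm : ∀ m : ℤ, a m * qPow m τ * (b (k - m) * qPow ((k - m : ℤ) : ℂ) τ) =
      a m * b (k - m) * qPow k τ := fun m => by
    have : qPow k τ = qPow m τ * qPow ((k - m : ℤ) : ℂ) τ := by
      rw [← qPow_add]
      congr 1
      push_cast
      ring
    rw [this]
    ring
  have h2 : HasSum (fun m => a m * b (k - m) * qPow k τ)
      (∑ m ∈ Finset.Icc M (k - N), a m * b (k - m) * qPow k τ) := by
    refine hasSum_sum_of_ne_finset_zero fun m hm => ?_
    simp only [Finset.mem_Icc, not_and_or, not_le] at hm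
    rcases hm with hm | hm
    · rw [ha m hm, zero_mul, zero_mul]
    · rw [hb (k - m) (by lia), mul_zero, zero_mul]
  rw [← Finset.sum_mul] at h2
  exact h2.congr_fun hterm

theorem HasQSeries.hasSum_nat {f : ℍ → ℂ} {a : ℤ → ℂ} (hf : HasQSeries f a)
    (ha : ∀ n < 0, a n = 0) (τ : ℍ) :
    HasSum (fun n : ℕ => a n • Function.Periodic.qParam 1 τ ^ n) (f τ) := by
  have h := (Nat.cast_injective (R := ℤ)).hasSum_iff (f := fun n : ℤ => a n * qPow n τ)
    (a := f τ) (by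
      intro n hn
      rw [ha n (by
        by_contra! h0
        exact hn ⟨n.toNat, by simp [h0]⟩), zero_mul])
  have h2 := h.mpr (hf τ)
  refine h2.congr_fun fun n => ?_
  simp [Function.comp_apply, ← qPow_natCast]

theorem hasQSeries_of_hasSum_nat {f : ℍ → ℂ} {c : ℕ → ℂ}
    (h : ∀ τ : ℍ, HasSum (fun n : ℕ => c n * Function.Periodic.qParam 1 τ ^ n) (f τ)) :
    HasQSeries f (fun n => if n < 0 then 0 else c n.toNat) := fun τ => by
  refine ((Nat.cast_injective (R := ℤ)).hasSum_iff ?_).mp ?_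
  · intro n hn
    have hn' : n < 0 := by
      by_contra! h0
      exact hn ⟨n.toNat, by simp [h0]⟩
    simp [hn']
  · refine (h τ).congr_fun fun n => ?_
    simp [Function.comp_apply, ← qPow_natCast]

/-- After division by q^N only a power series in q remains, and that is bounded at the cusp. -/
theorem HasQSeries.isBigO {f : ℍ → ℂ} {a : ℤ → ℂ} {N : ℤ} (hf : HasQSeries f a)
    (ha : ∀ n < N, a n = 0) : f =O[atImInfty] qPow N := by
  have h := (hf.qPow_mul (-N)).hasSum_nat (fun n hn => ha _ (by lia))
  have h2 := isBoundedAtImInfty_of_hasSum_qExpansion one_pos h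
  have h3 : f = fun τ => qPow N τ * (qPow ((-N : ℤ) : ℂ) τ * f τ) := by
    funext τ
    push_cast
    rw [← mul_assoc, mul_comm (qPow _ τ), qPow_neg_mul_self, one_mul]
  rw [h3]
  have h4 : (fun τ => qPow ((-N : ℤ) : ℂ) τ * f τ) =O[atImInfty] (fun _ => (1 : ℂ)) :=
    Asymptotics.IsBigO.trans h2 (Asymptotics.isBigO_of_le _ fun τ => by simp)
  simpa using (Asymptotics.isBigO_refl (qPow N) atImInfty).mul h4

/-- Pointwise convergence on the half-plane already implies locally uniform convergence, because
|q^n| depends monotonically on the height. Holomorphy and termwise differentiation then follow from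
Weierstrass. -/
theorem HasQSeries.mdifferentiable {f : ℍ → ℂ} {a : ℤ → ℂ} (hf : HasQSeries f a) :
    MDifferentiable 𝓘(ℂ) 𝓘(ℂ) f ∧
      HasQSeries (Derivative.normalizedDerivOfComplex f) (fun n => n * a n) := by
  set F : ℤ → ℂ → ℂ := fun n z => a n * cexp (2 * π * Complex.I * n * z) with hF
  have hFτ : ∀ (n : ℤ) (τ : ℍ), F n τ = a n * qPow n τ := fun n τ => rfl
  have key : ∀ τ : ℍ, ∃ U : Set ℂ, IsOpen U ∧ (τ : ℂ) ∈ U ∧ U ⊆ upperHalfPlaneSet ∧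
      ∃ u : ℤ → ℝ, Summable u ∧ ∀ n, ∀ w ∈ U, ‖F n w‖ ≤ u n := by
    intro τ
    -- On the strip between half and twice the height of τ, the term of index n is dominated by its
    -- value at the lower edge if n ≥ 0 and at the upper edge if n ≤ 0. The majorant adds both
    -- values.
    let τ₁ : ℍ := ⟨(τ.im / 2 : ℝ) * Complex.I, by simpa using τ.im_pos⟩
    let τ₂ : ℍ := ⟨(2 * τ.im : ℝ) * Complex.I, by simpa using τ.im_pos⟩
    have hτ₁ : τ₁.im = τ.im / 2 := by
      change ((τ.im / 2 : ℝ) * Complex.I : ℂ).im = _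
      simp
    have hτ₂ : τ₂.im = 2 * τ.im := by
      change ((2 * τ.im : ℝ) * Complex.I : ℂ).im = _
      simp
    have hU : IsOpen {w : ℂ | τ.im / 2 < w.im ∧ w.im < 2 * τ.im} :=
      (isOpen_lt continuous_const Complex.continuous_im).inter
        (isOpen_lt Complex.continuous_im continuous_const)
    refine ⟨_, hU, ⟨half_lt_self τ.im_pos, lt_two_mul_self τ.im_pos⟩,
      fun w hw => lt_trans (half_pos τ.im_pos) hw.1,
      fun n => ‖a n * qPow n τ₁‖ + ‖a n * qPow n τ₂‖,
      (hf τ₁).summable.norm.add (hf τ₂).summable.norm, fun n w hw => ?_⟩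
    let σ : ℍ := ⟨w, lt_trans (half_pos τ.im_pos) hw.1⟩
    have hσ : σ.im = w.im := rfl
    have e : F n w = a n * qPow n σ := rfl
    have norm_q : ∀ t : ℍ, ‖qPow (n : ℂ) t‖ = Real.exp (-(2 * π * n * t.im)) := fun t => by
      simpa using norm_qPow (n : ℝ) t
    rw [e]
    simp only [norm_mul, norm_q, hτ₁, hτ₂, hσ]
    rw [← mul_add]
    refine mul_le_mul_of_nonneg_left ?_ (norm_nonneg _)
    have hπ := Real.pi_pos
    rcases le_total 0 (n : ℝ) with hn | hn
    · refine le_add_of_le_of_nonneg (Real.exp_le_exp.mpr ?_) (Real.exp_pos _).le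
      have := mul_le_mul_of_nonneg_left hw.1.le (by positivity : 0 ≤ 2 * π * n)
      linarith
    · refine le_add_of_nonneg_of_le (Real.exp_pos _).le (Real.exp_le_exp.mpr ?_)
      have := mul_le_mul_of_nonneg_left hw.2.le (by
        have : 0 ≤ 2 * π * -(n : ℝ) := mul_nonneg (by positivity) (by linarith)
        exact this : 0 ≤ 2 * π * -(n : ℝ))
      linarith
  have hd : ∀ n : ℤ, Differentiable ℂ (F n) := fun n => by
    simp only [hF]
    fun_prop
  have hft : ∀ z ∈ upperHalfPlaneSet, (f ∘ ofComplex) z = ∑' n, F n z := fun z hz => by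
    rw [Function.comp_apply, ← (hf (ofComplex z)).tsum_eq]
    refine tsum_congr fun n => ?_
    rw [← hFτ, ofComplex_apply_of_im_pos hz]
  constructor
  · intro τ
    rw [UpperHalfPlane.mdifferentiableAt_iff]
    obtain ⟨U, hU, hτU, hUH, u, hu, hle⟩ := key τ
    have h := Complex.differentiableOn_tsum_of_summable_norm hu
      (fun n => (hd n).differentiableOn) hU hle
    exact (h.differentiableAt (hU.mem_nhds hτU)).congr_of_eventuallyEq
      (Filter.eventuallyEq_of_mem (hU.mem_nhds hτU) fun z hz => hft z (hUH hz))
  · intro τ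
    obtain ⟨U, hU, hτU, hUH, u, hu, hle⟩ := key τ
    have h := Complex.hasSum_deriv_of_summable_norm hu
      (fun n => (hd n).differentiableOn) hU hle hτU
    have h2 : deriv (f ∘ ofComplex) (τ : ℂ) = deriv (fun w => ∑' n, F n w) (τ : ℂ) :=
      (Filter.eventuallyEq_of_mem (hU.mem_nhds hτU) fun z hz => hft z (hUH hz)).deriv_eq
    rw [Derivative.normalizedDerivOfComplex, h2]
    refine (h.mul_left _).congr_fun fun n => ?_
    have h3 : HasDerivAt (F n)
        (a n * (cexp (2 * π * Complex.I * n * τ) * (2 * π * Complex.I * n))) (τ : ℂ) := by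
      refine ((HasDerivAt.cexp ?_).const_mul (a n))
      simpa using (hasDerivAt_id (τ : ℂ)).const_mul (2 * π * Complex.I * n)
    rw [h3.deriv, qPow]
    have := Complex.two_pi_I_ne_zero
    field_simp

theorem hasQSeries_of_isBoundedAtImInfty {f : ℍ → ℂ} (hf : MDifferentiable 𝓘(ℂ) 𝓘(ℂ) f)
    (hper : ∀ τ : ℍ, f ((1 : ℝ) +ᵥ τ) = f τ) (hbd : IsBoundedAtImInfty f) :
    ∃ a, HasQSeries f a ∧ ∀ n < 0, a n = 0 := by
  have hp : Function.Periodic (f ∘ ofComplex) (1 : ℝ) := by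
    intro w
    by_cases! hw : 0 < w.im
    · have h2 : 0 < (w + (1 : ℝ)).im := by simpa using hw
      simp only [Function.comp_apply, ofComplex_apply_of_im_pos hw, ofComplex_apply_of_im_pos h2]
      rw [← hper ⟨w, hw⟩]
      congr 1
      ext
      simp [UpperHalfPlane.coe_vadd, add_comm]
    -- Off the half-plane `ofComplex` has a constant default value, so periodicity is trivial there.
    · have h2 : (w + (1 : ℝ)).im ≤ 0 := by simpa using hw
      simp only [Function.comp_apply, ofComplex_apply_of_im_nonpos hw,
        ofComplex_apply_of_im_nonpos h2]
  refine ⟨_, hasQSeries_of_hasSum_nat fun τ =>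
    by simpa using UpperHalfPlane.hasSum_qExpansion one_pos hp hf hbd τ, fun n hn => ?_⟩
  simp [hn]

end

section

/-! ### Expansions of the scalar modular functions -/

/-- `f = x q ^ N + y q ^ (N + 1) + ⋯`. -/
def HasLead (f : ℍ → ℂ) (N : ℤ) (x y : ℂ) : Prop :=
  ∃ a, HasQSeries f a ∧ (∀ n < N, a n = 0) ∧ a N = x ∧ a (N + 1) = y

theorem HasLead.mul {f g : ℍ → ℂ} {M N : ℤ} {x y z w : ℂ} (hf : HasLead f M x y)
    (hg : HasLead g N z w) : HasLead (f * g) (M + N) (x * z) (x * w + y * z) := by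
  obtain ⟨a, ha, ha0, rfl, rfl⟩ := hf
  obtain ⟨b, hb, hb0, rfl, rfl⟩ := hg
  refine ⟨_, ha.mul hb ha0 hb0, fun n hn => ?_, ?_, ?_⟩
  · rw [Finset.Icc_eq_empty (by lia), Finset.sum_empty]
  · simp
  · have h1 : M + N + 1 - N = M + 1 := by ring
    have h2 : Finset.Icc M (M + 1) = {M, M + 1} := by
      ext i
      simp only [Finset.mem_Icc, Finset.mem_insert, Finset.mem_singleton]
      lia
    have h3 : M + N + 1 - M = N + 1 := by ring
    have h4 : M + N + 1 - (M + 1) = N := by ring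
    simp only [h1, h2]
    rw [Finset.sum_pair (by lia), h3, h4]

theorem HasLead.coeff_eq {f : ℍ → ℂ} {N : ℤ} {x y : ℂ} (hf : HasLead f N x y) :
    HasQSeries f (qCoeff f) ∧ (∀ n < N, qCoeff f n = 0) ∧ qCoeff f N = x ∧
      qCoeff f (N + 1) = y := by
  obtain ⟨a, ha, h⟩ := hf
  rw [ha.qCoeff_eq]
  exact ⟨ha, h⟩

theorem HasLead.mdifferentiable {f : ℍ → ℂ} {N : ℤ} {x y : ℂ} (hf : HasLead f N x y) :
    MDifferentiable 𝓘(ℂ) 𝓘(ℂ) f :=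
  hf.coeff_eq.1.mdifferentiable.1

theorem HasQSeries.vadd_one {f : ℍ → ℂ} {a : ℤ → ℂ} (hf : HasQSeries f a) (τ : ℍ) :
    f ((1 : ℝ) +ᵥ τ) = f τ := by
  have := hf ((1 : ℝ) +ᵥ τ)
  simp only [qPow_intCast_vadd_one] at this
  exact this.unique (hf τ)

/-- Three coefficients are tracked because the constant terms cancel in E₄³ - E₆²: the first two
coefficients of Δ come from the terms in q and q². -/
theorem HasQSeries.mul_coeff_two {f g : ℍ → ℂ} {a b : ℤ → ℂ} (hf : HasQSeries f a)
    (hg : HasQSeries g b) (ha : ∀ n < 0, a n = 0) (hb : ∀ n < 0, b n = 0) :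
    ∃ c, HasQSeries (f * g) c ∧ (∀ n < 0, c n = 0) ∧ c 0 = a 0 * b 0 ∧
      c 1 = a 0 * b 1 + a 1 * b 0 ∧ c 2 = a 0 * b 2 + a 1 * b 1 + a 2 * b 0 := by
  refine ⟨_, hf.mul hg ha hb, fun n hn => ?_, by simp, ?_, ?_⟩
  · rw [Finset.Icc_eq_empty (by lia), Finset.sum_empty]
  · have : Finset.Icc (0 : ℤ) 1 = {0, 1} := by decide
    simp [this]
  · have : Finset.Icc (0 : ℤ) 2 = {0, 1, 2} := by decide
    simp [this, add_assoc]

theorem hasQSeries_E {k : ℕ} (hk : 3 ≤ k) (hk2 : Even k) :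
    ∃ a, HasQSeries (ModularForm.E hk) a ∧ (∀ n < 0, a n = 0) ∧ a 0 = 1 ∧
      a 1 = -(2 * k / bernoulli k : ℂ) ∧
      a 2 = -(2 * k / bernoulli k : ℂ) * (1 + 2 ^ (k - 1)) := by
  have h := hasQSeries_of_hasSum_nat fun τ => ModularForm.hasSum_qExpansion
    (ModularForm.E hk) one_pos one_mem_strictPeriods_SL τ
  have hσ : ArithmeticFunction.sigma (k - 1) 2 = 1 + 2 ^ (k - 1) := by
    rw [ArithmeticFunction.sigma_apply, Nat.Prime.divisors Nat.prime_two,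
      Finset.sum_pair (by norm_num), one_pow]
  refine ⟨_, h, fun n hn => by simp [hn], ?_, ?_, ?_⟩
  · simpa using EisensteinSeries.E_qExpansion_coeff_zero hk hk2
  · simpa using EisensteinSeries.E_qExpansion_coeff hk hk2 1
  · simpa [hσ] using EisensteinSeries.E_qExpansion_coeff hk hk2 2

theorem hasLead_discriminant : HasLead ModularForm.discriminant 1 1 (-24) := by
  obtain ⟨a, ha, ha0, a0, a1, a2⟩ := hasQSeries_E (k := 4) (by norm_num) ⟨2, rfl⟩
  obtain ⟨b, hb, hb0, b0, b1, b2⟩ := hasQSeries_E (k := 6) (by norm_num) ⟨3, rfl⟩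
  obtain ⟨c, hc, hc0, c0, c1, c2⟩ := ha.mul_coeff_two ha ha0 ha0
  obtain ⟨e, he, he0, e0, e1, e2⟩ := hc.mul_coeff_two ha hc0 ha0
  obtain ⟨g, hg, hg0, g0, g1, g2⟩ := hb.mul_coeff_two hb hb0 hb0
  have h4 : bernoulli 4 = -1 / 30 := by decide +kernel
  have h6 : bernoulli 6 = 1 / 42 := by decide +kernel
  rw [h4] at a1 a2
  rw [h6] at b1 b2
  norm_num at a1 a2 b1 b2
  have hΔ : ModularForm.discriminant = (1 / 1728 : ℂ) •
      ((ModularForm.E (k := 4) (by norm_num) : ℍ → ℂ) * ModularForm.E (k := 4) (by norm_num) *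
        ModularForm.E (k := 4) (by norm_num) - (ModularForm.E (k := 6) (by norm_num) : ℍ → ℂ) *
        ModularForm.E (k := 6) (by norm_num)) := by
    funext τ
    rw [ModularForm.discriminant_eq_E₄_cube_sub_E₆_sq]
    simp only [Pi.smul_apply, Pi.sub_apply, Pi.mul_apply, smul_eq_mul]
    ring
  rw [hΔ]
  refine ⟨_, (he.sub hg).smul _, fun n hn => ?_, ?_, ?_⟩
  · rcases (show n < 0 ∨ n = 0 by lia) with h | rfl
    · simp [he0 n h, hg0 n h]
    · simp [e0, g0, c0, a0, b0]
  · simp only [Pi.smul_apply, Pi.sub_apply, smul_eq_mul, e1, g1, c0, c1, a0, a1, b0, b1]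
    norm_num
  · simp only [Pi.smul_apply, Pi.sub_apply, smul_eq_mul, one_add_one_eq_two, e2, g2, c0, c1, c2,
      a0, a1, a2, b0, b1, b2]
    norm_num

/-- The function q/Δ is holomorphic because Δ has no zeros, periodic, and bounded at the cusp
because q = O(Δ). So it is a power series in q, and its first coefficients are solved from Δ · Δ⁻¹ =
1. -/
theorem hasLead_discriminant_inv : HasLead ModularForm.discriminant⁻¹ (-1) 1 24 := by
  have hΔ := hasLead_discriminant
  have hΔp := hΔ.coeff_eq.1.vadd_one
  have hmd : MDifferentiable 𝓘(ℂ) 𝓘(ℂ) (fun τ => qPow (1 : ℤ) τ * ModularForm.discriminant⁻¹ τ) := by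
    have h1 := hΔ.mdifferentiable
    have h2 := mdifferentiable_qPow ((1 : ℤ) : ℂ)
    exact h2.div h1 ModularForm.discriminant_ne_zero
  have hbd : IsBoundedAtImInfty
      (fun τ => qPow (1 : ℤ) τ * ModularForm.discriminant⁻¹ τ) := by
    have h : qPow ((1 : ℤ) : ℂ) =O[atImInfty] ModularForm.discriminant := by
      refine Asymptotics.IsBigO.trans (Asymptotics.isBigO_of_le _ fun τ => ?_)
        ModularForm.exp_isBigO_discriminant
      rw [Real.norm_of_nonneg (Real.exp_pos _).le]
      have := norm_qPow 1 τ
      push_cast at this ⊢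
      rw [this]
      simp
    have h2 := h.mul (Asymptotics.isBigO_refl ModularForm.discriminant⁻¹ atImInfty)
    refine h2.trans (Asymptotics.isBigO_of_le _ fun τ => ?_)
    simp [ModularForm.discriminant_ne_zero]
  obtain ⟨a, ha, hΔ0, hΔ1, hΔ2⟩ := hΔ
  obtain ⟨b, hb, hb0⟩ := hasQSeries_of_isBoundedAtImInfty hmd (fun τ => by
    rw [qPow_intCast_vadd_one]
    rw [Pi.inv_apply, Pi.inv_apply, hΔp]) hbd
  have hb' := hb.of_qPow_mul
  have hb0' : ∀ n < -1, b (n + 1) = 0 := fun n hn => hb0 _ (by lia)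
  have hprod := HasLead.mul ⟨a, ha, hΔ0, hΔ1, hΔ2⟩ ⟨_, hb', hb0', rfl, rfl⟩
  have h1 : ModularForm.discriminant * ModularForm.discriminant⁻¹ = fun _ => (1 : ℂ) := by
    funext τ
    simp [ModularForm.discriminant_ne_zero]
  rw [h1] at hprod
  obtain ⟨h2, h3, h4, h5⟩ := hprod.coeff_eq
  rw [(hasQSeries_const 1).qCoeff_eq] at h4 h5
  simp at h4 h5
  refine ⟨_, hb', hb0', ?_, ?_⟩
  · simp [← h4]
  · simp only [neg_add_cancel, zero_add]
    linear_combination -h5 - 24 * h4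

theorem hasLead_E {k : ℕ} (hk : 3 ≤ k) (hk2 : Even k) :
    HasLead (ModularForm.E hk) 0 1 (-(2 * k / bernoulli k : ℂ)) := by
  obtain ⟨a, ha, ha0, a0, a1, -⟩ := hasQSeries_E hk hk2
  exact ⟨a, ha, ha0, a0, by simpa using a1⟩

theorem hasLead_hauptmodul : HasLead hauptmodul (-1) 1 0 := by
  have h := hasLead_E (k := 4) (by norm_num) ⟨2, rfl⟩
  have h4 : bernoulli 4 = -1 / 30 := by decide +kernel
  rw [h4] at h
  obtain ⟨a, ha, ha0, a0, a1⟩ := ((h.mul h).mul h).mul hasLead_discriminant_inv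
  have e : hauptmodul = (ModularForm.E (k := 4) (by norm_num) : ℍ → ℂ) *
      (ModularForm.E (k := 4) (by norm_num) : ℍ → ℂ) *
      (ModularForm.E (k := 4) (by norm_num) : ℍ → ℂ) * ModularForm.discriminant⁻¹ - fun _ => 744 := by
    funext τ
    simp only [hauptmodul, Pi.sub_apply, Pi.mul_apply, Pi.inv_apply]
    rw [div_eq_mul_inv]
    ring
  rw [e]
  simp only [add_zero, zero_add, neg_add_cancel] at ha0 a0 a1
  refine ⟨_, ha.sub (hasQSeries_const 744), fun n hn => ?_, ?_, ?_⟩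
  · simp [ha0 n hn, (show n ≠ 0 by lia)]
  · simp [a0]
  · simp only [Pi.sub_apply, neg_add_cancel, a1, Pi.single_eq_same]
    norm_num

theorem hasLead_calE : HasLead calE (-1) 1 (-240) := by
  have h := (hasLead_E (k := 10) (by norm_num) ⟨5, rfl⟩).mul hasLead_discriminant_inv
  have h10 : bernoulli 10 = 5 / 66 := by decide +kernel
  rw [h10] at h
  have e : calE = (ModularForm.E (k := 10) (by norm_num) : ℍ → ℂ) *
      ModularForm.discriminant⁻¹ := by
    funext τ
    simp only [calE, Pi.mul_apply, Pi.inv_apply]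
    rw [div_eq_mul_inv]
  rw [e]
  norm_num at h
  exact h

/-! ### Transformation laws of the scalar functions. -/

theorem E_smul {k : ℕ} (hk : 3 ≤ k) (γ : SL(2, ℤ)) (τ : ℍ) :
    ModularForm.E hk (γ • τ) = denom γ τ ^ k * ModularForm.E hk τ := by
  have h := SlashInvariantForm.slash_action_eqn'' (Γ := 𝒮ℒ) (ModularForm.E hk)
    (γ := (γ : GL (Fin 2) ℝ)) (MonoidHom.mem_range.mpr ⟨γ, rfl⟩) τ
  rw [zpow_natCast] at h
  exact h

theorem discriminant_smul (γ : SL(2, ℤ)) (τ : ℍ) :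
    ModularForm.discriminant (γ • τ) = denom γ τ ^ 12 * ModularForm.discriminant τ :=
  SlashInvariantForm.slash_action_eqn'' (Γ := 𝒮ℒ) CuspForm.discriminant
    (γ := (γ : GL (Fin 2) ℝ)) (MonoidHom.mem_range.mpr ⟨γ, rfl⟩) τ

theorem hauptmodul_smul (γ : SL(2, ℤ)) (τ : ℍ) : hauptmodul (γ • τ) = hauptmodul τ := by
  rw [hauptmodul, hauptmodul, E_smul, discriminant_smul, mul_pow, ← pow_mul,
    mul_div_mul_left _ _ (pow_ne_zero _ (denom_ne_zero _ _))]

theorem calE_smul (γ : SL(2, ℤ)) (τ : ℍ) : denom γ τ ^ 2 * calE (γ • τ) = calE τ := by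
  have h := denom_ne_zero γ τ
  have h2 := ModularForm.discriminant_ne_zero τ
  rw [calE, calE, E_smul, discriminant_smul]
  field_simp

end

section

/-! ### Expansions of vector-valued modular functions -/

variable {d : ℕ} {ρ : SL(2, ℤ) →* GL (Fin d) ℂ} {Λ : Fin d → ℚ}

theorem mdifferentiable_pi {X : ℍ → Fin d → ℂ} :
    MDifferentiable 𝓘(ℂ) 𝓘(ℂ, Fin d → ℂ) X ↔
      ∀ ξ, MDifferentiable 𝓘(ℂ) 𝓘(ℂ) (fun τ => X τ ξ) := by
  constructor
  · intro h ξ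
    exact ((ContinuousLinearMap.proj (R := ℂ) (φ := fun _ : Fin d => ℂ)
      ξ).differentiable.mdifferentiable).comp h
  · intro h τ
    have h1 := fun ξ => UpperHalfPlane.mdifferentiableAt_iff.mp (h ξ τ)
    have h2 : DifferentiableAt ℂ (X ∘ ofComplex) τ := differentiableAt_pi.mpr h1
    have h3 := h2.mdifferentiableAt.comp τ (UpperHalfPlane.mdifferentiable_coe τ)
    have h4 : (X ∘ ofComplex) ∘ UpperHalfPlane.coe = X := by
      funext σ
      simp
    rwa [h4] at h3

theorem twist_eq (X : ℍ → Fin d → ℂ) (ξ : Fin d) (τ : ℍ) :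
    qPow (Λ ξ) τ * twist Λ X ξ τ = X τ ξ := by
  rw [twist, ← mul_assoc, mul_comm (qPow _ τ), qPow_neg_mul_self, one_mul]

theorem vecCoeff_eq {X : ℍ → Fin d → ℂ} {ξ : Fin d} {a : ℤ → ℂ}
    (h : HasQSeries (twist Λ X ξ) a) (n : ℤ) : vecCoeff Λ X n ξ = a n := by
  rw [vecCoeff, h.qCoeff_eq]

/-- Holomorphy need not be assumed: it follows from convergence of the expansion. -/
theorem mem_modFun_of_hasQSeries (hΛ : IsExponent ρ Λ) {X : ℍ → Fin d → ℂ}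
    (hmod : ∀ (γ : SL(2, ℤ)) (τ : ℍ), X (γ • τ) = (ρ γ : Matrix (Fin d) (Fin d) ℂ) *ᵥ X τ)
    {a : Fin d → ℤ → ℂ} (ha : ∀ ξ, HasQSeries (twist Λ X ξ) (a ξ)) {N : ℤ}
    (hN : ∀ ξ, ∀ n < N, a ξ n = 0) : X ∈ modFun ρ := by
  refine ⟨mdifferentiable_pi.mpr fun ξ => ?_, hmod, (hasFinitePoles_iff hΛ X).mpr fun ξ =>
    ⟨a ξ, ha ξ, (Set.finite_Ico N 0).subset fun n hn => ?_⟩⟩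
  · have := (mdifferentiable_qPow (Λ ξ : ℂ)).mul (ha ξ).mdifferentiable.1
    have e : (fun τ => X τ ξ) = qPow (Λ ξ) * twist Λ X ξ := by
      funext τ
      exact (twist_eq X ξ τ).symm
    rw [e]
    exact this
  · exact ⟨by
      by_contra! h
      exact hn.2 (hN ξ n h), hn.1⟩

theorem exists_vecCoeff_eq_zero (hΛ : IsExponent ρ Λ) {X : ℍ → Fin d → ℂ} (hX : X ∈ modFun ρ) :
    ∃ N : ℤ, ∀ n < N, vecCoeff Λ X n = 0 := by
  obtain ⟨b, hb⟩ := (vecCoeff_support_finite hΛ hX).bddAbove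
  refine ⟨-(b : ℤ), fun n hn => ?_⟩
  by_contra h
  have h0 : 0 < -n := by
    have := b.pos
    lia
  let m : ℕ+ := ⟨(-n).toNat, by lia⟩
  have hm : (m : ℤ) = -n := by
    change (((-n).toNat : ℕ) : ℤ) = _
    lia
  have h2 : m ≤ b := hb (by simpa [hm] using h)
  have h3 : (m : ℤ) ≤ b := by exact_mod_cast h2
  lia

/-- The coefficient `X[n]` as a linear function of `X`. -/
def vecCoeffL (hΛ : IsExponent ρ Λ) (n : ℤ) : modFun ρ →ₗ[ℂ] (Fin d → ℂ) where
  toFun X := vecCoeff Λ X n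
  map_add' X Y := by
    ext ξ
    have h := (hasQSeries_of_mem hΛ X.2 ξ).add (hasQSeries_of_mem hΛ Y.2 ξ)
    rw [← twist_add] at h
    exact congrFun h.qCoeff_eq n
  map_smul' c X := by
    ext ξ
    have h := (hasQSeries_of_mem hΛ X.2 ξ).smul c
    rw [← twist_smul] at h
    exact congrFun h.qCoeff_eq n

@[simp]
theorem vecCoeffL_apply (hΛ : IsExponent ρ Λ) (n : ℤ) (X : modFun ρ) :
    vecCoeffL hΛ n X = vecCoeff Λ X n := rfl

theorem principalPart_apply (hΛ : IsExponent ρ Λ) (X : modFun ρ) (n : ℕ+) :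
    principalPart ρ Λ hΛ X n = vecCoeff Λ X (-(n : ℤ)) := rfl

theorem principalPart_eq_zero_iff (hΛ : IsExponent ρ Λ) (X : modFun ρ) :
    principalPart ρ Λ hΛ X = 0 ↔ ∀ n < 0, vecCoeff Λ X n = 0 := by
  constructor
  · intro h n hn
    have : vecCoeff Λ X (-(((-n).toNat : ℕ) : ℤ)) = 0 :=
      DFunLike.congr_fun h (⟨(-n).toNat, by lia⟩ : ℕ+)
    have h2 : -(((-n).toNat : ℕ) : ℤ) = n := by lia
    rwa [h2] at this
  · intro h
    ext1 n
    rw [principalPart_apply, h _ (by have := n.pos; lia)]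
    rfl

theorem eq_zero_of_vecCoeff_eq_zero (hΛ : IsExponent ρ Λ) {X : ℍ → Fin d → ℂ}
    (hX : X ∈ modFun ρ) (h : ∀ n, vecCoeff Λ X n = 0) : X = 0 := by
  funext τ ξ
  rw [← twist_eq (Λ := Λ) X ξ τ]
  have h1 := hasQSeries_of_mem hΛ hX ξ τ
  simp only [h, Pi.zero_apply, zero_mul] at h1
  rw [h1.unique hasSum_zero, mul_zero, Pi.zero_apply, Pi.zero_apply]

/-! ### Multiplication by scalar modular functions, and differentiation. -/

theorem HasLead.smul_mem_modFun {f : ℍ → ℂ} {M : ℤ} {x y : ℂ} (hf : HasLead f M x y)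
    (hmod : ∀ (γ : SL(2, ℤ)) (τ : ℍ), f (γ • τ) = f τ) (hΛ : IsExponent ρ Λ)
    {X : ℍ → Fin d → ℂ} (hX : X ∈ modFun ρ) : f • X ∈ modFun ρ := by
  obtain ⟨N, hN⟩ := exists_vecCoeff_eq_zero hΛ hX
  obtain ⟨h1, h2, -, -⟩ := hf.coeff_eq
  refine mem_modFun_of_hasQSeries (N := M + N)
    (a := fun ξ k => ∑ m ∈ Finset.Icc M (k - N), qCoeff f m * vecCoeff Λ X (k - m) ξ)
    hΛ (fun γ τ => ?_) (fun ξ => ?_) fun ξ n hn => ?_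
  · simp only [Pi.smul_apply', hmod, hX.2.1, Matrix.mulVec_smul]
  · have := h1.mul (hasQSeries_of_mem hΛ hX ξ) h2 (fun n hn => by rw [hN n hn]; rfl)
    convert this using 1
    funext τ
    simp only [twist, Pi.smul_apply', Pi.mul_apply, Pi.smul_apply, smul_eq_mul]
    ring
  · rw [Finset.Icc_eq_empty (by lia), Finset.sum_empty]

theorem HasLead.vecCoeff_smul {f : ℍ → ℂ} {M : ℤ} {x y : ℂ} (hf : HasLead f M x y)
    (hΛ : IsExponent ρ Λ) {X : ℍ → Fin d → ℂ} (hX : X ∈ modFun ρ) {N : ℤ}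
    (hN : ∀ n < N, vecCoeff Λ X n = 0) (k : ℤ) :
    vecCoeff Λ (f • X) k = ∑ m ∈ Finset.Icc M (k - N), qCoeff f m • vecCoeff Λ X (k - m) := by
  obtain ⟨h1, h2, -, -⟩ := hf.coeff_eq
  funext ξ
  have := h1.mul (hasQSeries_of_mem hΛ hX ξ) h2 (fun n hn => by rw [hN n hn]; rfl)
  have e : twist Λ (f • X) ξ = f * twist Λ X ξ := by
    funext τ
    simp only [twist, Pi.smul_apply', Pi.mul_apply, Pi.smul_apply, smul_eq_mul]
    ring
  rw [← e] at this
  rw [vecCoeff_eq this]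
  simp

theorem hauptmodul_smul_mem (hΛ : IsExponent ρ Λ) {X : ℍ → Fin d → ℂ} (hX : X ∈ modFun ρ) :
    hauptmodul • X ∈ modFun ρ :=
  hasLead_hauptmodul.smul_mem_modFun hauptmodul_smul hΛ hX

/-- The derivation `(E₁₀ / Δ) (1 / 2 π i) d / dτ`. -/
def modDeriv (X : ℍ → Fin d → ℂ) : ℍ → Fin d → ℂ := fun τ ξ =>
  calE τ * Derivative.normalizedDerivOfComplex (fun σ => X σ ξ) τ

theorem normalizedDeriv_sum {ι : Type*} {s : Finset ι} {c : ι → ℂ} {F : ι → ℍ → ℂ}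
    (hF : ∀ i, MDifferentiable 𝓘(ℂ) 𝓘(ℂ) (F i)) :
    Derivative.normalizedDerivOfComplex (fun τ => ∑ i ∈ s, c i * F i τ) =
      fun τ => ∑ i ∈ s, c i * Derivative.normalizedDerivOfComplex (F i) τ := by
  funext τ
  have h : HasDerivAt ((fun τ => ∑ i ∈ s, c i * F i τ) ∘ ofComplex)
      (∑ i ∈ s, c i * deriv (F i ∘ ofComplex) τ) τ := by
    have := HasDerivAt.fun_sum (u := s) (x := (τ : ℂ)) fun i _ =>
      (UpperHalfPlane.mdifferentiableAt_iff.mp (hF i τ)).hasDerivAt.const_mul (c i)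
    exact this
  rw [Derivative.normalizedDerivOfComplex, h.deriv, Finset.mul_sum]
  refine Finset.sum_congr rfl fun i _ => ?_
  rw [Derivative.normalizedDerivOfComplex]
  ring

-- The derivative of a weight 0 function has weight 2 with no correction term, and E₁₀/Δ has weight
-- -2. As ρ(γ) is constant in τ, it commutes with the derivative.
open scoped ModularForm in
theorem modDeriv_smul {X : ℍ → Fin d → ℂ} (hX : X ∈ modFun ρ) (γ : SL(2, ℤ)) (τ : ℍ) :
    modDeriv X (γ • τ) = (ρ γ : Matrix (Fin d) (Fin d) ℂ) *ᵥ modDeriv X τ := by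
  have hmd := mdifferentiable_pi.mp hX.1
  funext ξ
  have h1 := congrFun (Derivative.normalizedDerivOfComplex_SL_slash (k := 0) (hmd ξ) (γ := γ)) τ
  have h2 : (fun σ => X σ ξ) ∣[(0 : ℤ)] γ =
      fun σ => ∑ i, (ρ γ : Matrix (Fin d) (Fin d) ℂ) ξ i * X σ i := by
    funext σ
    rw [ModularForm.SL_slash_apply, hX.2.1]
    simp [Matrix.mulVec, dotProduct]
  rw [h2, normalizedDeriv_sum hmd] at h1
  simp only [Int.cast_zero, zero_mul, Pi.sub_apply, sub_zero, ModularForm.SL_slash_apply] at h1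
  have hd := denom_ne_zero γ τ
  have h3 : Derivative.normalizedDerivOfComplex (fun σ => X σ ξ) (γ • τ) =
      denom γ τ ^ 2 * ∑ i, (ρ γ : Matrix (Fin d) (Fin d) ℂ) ξ i *
        Derivative.normalizedDerivOfComplex (fun σ => X σ i) τ := by
    rw [h1, show (-(0 + 2) : ℤ) = -2 by ring, _root_.zpow_neg]
    field_simp
  simp only [modDeriv, Matrix.mulVec, dotProduct]
  rw [h3, ← calE_smul γ τ, Finset.mul_sum, Finset.mul_sum]
  refine Finset.sum_congr rfl fun i _ => ?_
  ring

/-- Product rule applied to q^Λ times the twisted function. The factor n + Λ is how Λ enters the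
differential equation. -/
theorem hasQSeries_twist_deriv (hΛ : IsExponent ρ Λ) {X : ℍ → Fin d → ℂ} (hX : X ∈ modFun ρ)
    (ξ : Fin d) : HasQSeries
      (twist Λ (fun τ ξ => Derivative.normalizedDerivOfComplex (fun σ => X σ ξ) τ) ξ)
      (fun n => (n + Λ ξ) * vecCoeff Λ X n ξ) := by
  have h := hasQSeries_of_mem hΛ hX ξ
  obtain ⟨h1, h2⟩ := h.mdifferentiable
  have h3 : (fun σ => X σ ξ) = qPow (Λ ξ) * twist Λ X ξ := by
    funext τ
    exact (twist_eq X ξ τ).symm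
  have h4 : Derivative.normalizedDerivOfComplex (qPow (Λ ξ)) = (Λ ξ : ℂ) • qPow (Λ ξ) := by
    funext τ
    have h5 : HasDerivAt (fun z : ℂ => cexp (2 * π * Complex.I * Λ ξ * z))
        (cexp (2 * π * Complex.I * Λ ξ * τ) * (2 * π * Complex.I * Λ ξ)) (τ : ℂ) := by
      refine HasDerivAt.cexp ?_
      simpa using (hasDerivAt_id (τ : ℂ)).const_mul (2 * π * Complex.I * (Λ ξ : ℂ))
    have h6 : (qPow (Λ ξ) ∘ ofComplex) =ᶠ[𝓝 (τ : ℂ)]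
        (fun z : ℂ => cexp (2 * π * Complex.I * Λ ξ * z)) :=
      Filter.eventuallyEq_of_mem (isOpen_upperHalfPlaneSet.mem_nhds τ.im_pos) fun z hz => by
        simp [qPow, Function.comp_apply, ofComplex_apply_of_im_pos hz]
    rw [Derivative.normalizedDerivOfComplex, h6.deriv_eq, h5.deriv]
    simp only [Pi.smul_apply, smul_eq_mul, qPow]
    have := Complex.two_pi_I_ne_zero
    field_simp
  have h5 := h2.add (h.smul (Λ ξ : ℂ))
  convert h5 using 1
  · funext τ
    simp only [twist]
    rw [h3, Derivative.normalizedDerivOfComplex_mul _ _ (mdifferentiable_qPow _) h1, h4]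
    simp only [Pi.add_apply, Pi.mul_apply, Pi.smul_apply, smul_eq_mul]
    linear_combination (Derivative.normalizedDerivOfComplex (twist Λ X ξ) τ +
      Λ ξ * twist Λ X ξ τ) * qPow_neg_mul_self (Λ ξ) τ
  · funext n
    simp only [Pi.add_apply, Pi.smul_apply, smul_eq_mul]
    ring

theorem hasQSeries_twist_modDeriv (hΛ : IsExponent ρ Λ) {X : ℍ → Fin d → ℂ} (hX : X ∈ modFun ρ)
    {N : ℤ} (hN : ∀ n < N, vecCoeff Λ X n = 0) (ξ : Fin d) :
    HasQSeries (twist Λ (modDeriv X) ξ) (fun k => ∑ m ∈ Finset.Icc (-1) (k - N),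
      qCoeff calE m * (((k - m : ℤ) + Λ ξ) * vecCoeff Λ X (k - m) ξ)) := by
  obtain ⟨h1, h2, -, -⟩ := hasLead_calE.coeff_eq
  have := h1.mul (hasQSeries_twist_deriv hΛ hX ξ) h2 (N := N) (fun n hn => by rw [hN n hn]; simp)
  convert this using 1
  funext τ
  simp only [twist, modDeriv, Pi.mul_apply]
  ring

theorem modDeriv_mem (hΛ : IsExponent ρ Λ) {X : ℍ → Fin d → ℂ} (hX : X ∈ modFun ρ) :
    modDeriv X ∈ modFun ρ := by
  obtain ⟨N, hN⟩ := exists_vecCoeff_eq_zero hΛ hX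
  refine mem_modFun_of_hasQSeries (N := -1 + N) hΛ (modDeriv_smul hX)
    (hasQSeries_twist_modDeriv hΛ hX hN) fun ξ n hn => ?_
  rw [Finset.Icc_eq_empty (by lia), Finset.sum_empty]

/-! ### Change of exponent matrix. -/

theorem vecCoeff_shift {Λ' : Fin d → ℚ} (hΛ : IsExponent ρ Λ) {X : ℍ → Fin d → ℂ}
    (hX : X ∈ modFun ρ) {ξ : Fin d} {k : ℤ} (hk : Λ' ξ = Λ ξ + k) (n : ℤ) :
    vecCoeff Λ' X n ξ = vecCoeff Λ X (n + k) ξ := by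
  have h := (hasQSeries_of_mem hΛ hX ξ).qPow_mul (-k)
  have e : twist Λ' X ξ = fun τ => qPow ((-k : ℤ) : ℂ) τ * twist Λ X ξ τ := by
    funext τ
    simp only [twist]
    rw [← mul_assoc, ← qPow_add, hk]
    congr 2
    push_cast
    ring
  rw [← e] at h
  rw [vecCoeff_eq h, sub_neg_eq_add]

theorem IsExponent.add_int (hΛ : IsExponent ρ Λ) {Λ' : Fin d → ℚ} {k : Fin d → ℤ}
    (hk : ∀ ξ, Λ' ξ = Λ ξ + k ξ) : IsExponent ρ Λ' := by
  rw [IsExponent, hΛ]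
  congr 1
  funext ξ
  rw [hk]
  push_cast
  rw [mul_add, Complex.exp_add, mul_comm _ (k ξ : ℂ), Complex.exp_int_mul_two_pi_mul_I, mul_one]

theorem IsExponent.exists_int (hΛ : IsExponent ρ Λ) {Λ' : Fin d → ℚ} (hΛ' : IsExponent ρ Λ') :
    ∃ k : Fin d → ℤ, ∀ ξ, Λ' ξ = Λ ξ + k ξ := by
  have : ∀ ξ, ∃ k : ℤ, Λ' ξ = Λ ξ + k := fun ξ => by
    have h1 := congrFun (congrFun (hΛ'.symm.trans hΛ) ξ) ξ
    simp only [Matrix.diagonal_apply_eq] at h1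
    obtain ⟨k, hk⟩ := Complex.exp_eq_exp_iff_exists_int.mp h1
    refine ⟨k, ?_⟩
    have h2 : (Λ' ξ : ℂ) = Λ ξ + k := by
      apply mul_left_cancel₀ Complex.two_pi_I_ne_zero
      rw [hk]; ring
    exact_mod_cast h2
  choose k hk using this
  exact ⟨k, hk⟩

end

section

/-! ### The contragredient representation and the pairing -/

variable {d : ℕ} {ρ : SL(2, ℤ) →* GL (Fin d) ℂ} {Λ : Fin d → ℚ}

/-- The contragredient of a matrix representation. -/
def dualRep (ρ : SL(2, ℤ) →* GL (Fin d) ℂ) : SL(2, ℤ) →* GL (Fin d) ℂ :=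
  MonoidHom.toHomUnits
    { toFun := fun γ => (ρ γ⁻¹ : Matrix (Fin d) (Fin d) ℂ)ᵀ
      map_one' := by simp
      map_mul' := fun γ δ => by
        rw [_root_.mul_inv_rev, map_mul, Units.val_mul, Matrix.transpose_mul] }

theorem coe_dualRep (ρ : SL(2, ℤ) →* GL (Fin d) ℂ) (γ : SL(2, ℤ)) :
    (dualRep ρ γ : Matrix (Fin d) (Fin d) ℂ) = (ρ γ⁻¹ : Matrix (Fin d) (Fin d) ℂ)ᵀ := rfl

theorem dualRep_neg_one (h : ρ (-1) = 1) : dualRep ρ (-1) = 1 := by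
  ext1
  rw [coe_dualRep, map_inv, h]
  simp

theorem IsExponent.dualRep (hΛ : IsExponent ρ Λ) : IsExponent (dualRep ρ) (-Λ) := by
  have h1 : (ρ ModularGroup.T : Matrix (Fin d) (Fin d) ℂ) *
      (ρ ModularGroup.T⁻¹ : Matrix (Fin d) (Fin d) ℂ) = 1 := by
    rw [← Units.val_mul, ← map_mul, mul_inv_cancel, map_one, Units.val_one]
  have h2 : (Matrix.diagonal fun ξ => cexp (2 * π * Complex.I * ((-Λ) ξ : ℂ))) *
      (ρ ModularGroup.T : Matrix (Fin d) (Fin d) ℂ) = 1 := by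
    rw [hΛ, Matrix.diagonal_mul_diagonal, ← Matrix.diagonal_one]
    congr 1
    funext ξ
    rw [← Complex.exp_add, ← Complex.exp_zero]
    congr 1
    simp
  have h3 := left_inv_eq_right_inv h2 h1
  rw [IsExponent, coe_dualRep]
  simp only [Pi.neg_apply] at h3 ⊢
  rw [← h3, Matrix.diagonal_transpose]

theorem pairing_smul {X Y : ℍ → Fin d → ℂ} (hX : X ∈ modFun ρ) (hY : Y ∈ modFun (dualRep ρ))
    (γ : SL(2, ℤ)) (τ : ℍ) : X (γ • τ) ⬝ᵥ Y (γ • τ) = X τ ⬝ᵥ Y τ := by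
  rw [hX.2.1, hY.2.1, coe_dualRep, ← Matrix.vecMul_transpose, ← Matrix.dotProduct_mulVec,
    Matrix.mulVec_mulVec, ← Matrix.transpose_mul, ← Units.val_mul, ← map_mul, inv_mul_cancel,
    map_one, Units.val_one, Matrix.transpose_one, Matrix.one_mulVec]

/-- With opposite exponents the fractional powers q^Λ and q^(-Λ) cancel in each product of
components, so the pairing is an honest Laurent series in q. -/
theorem hasQSeries_pairing {Λ' : Fin d → ℚ} (hΛ : IsExponent ρ Λ)
    (hΛ' : IsExponent (dualRep ρ) Λ') (hneg : ∀ ξ, Λ ξ = -Λ' ξ) {X Y : ℍ → Fin d → ℂ}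
    (hX : X ∈ modFun ρ) (hY : Y ∈ modFun (dualRep ρ)) {M N : ℤ}
    (hM : ∀ n < M, vecCoeff Λ X n = 0) (hN : ∀ n < N, vecCoeff Λ' Y n = 0) :
    HasQSeries (fun τ => X τ ⬝ᵥ Y τ)
      (fun k => ∑ m ∈ Finset.Icc M (k - N), vecCoeff Λ X m ⬝ᵥ vecCoeff Λ' Y (k - m)) := by
  have h := HasQSeries.sum (s := Finset.univ) fun ξ (_ : ξ ∈ Finset.univ) =>
    (hasQSeries_of_mem hΛ hX ξ).mul (hasQSeries_of_mem hΛ' hY ξ)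
      (fun n hn => by rw [hM n hn]; rfl) (fun n hn => by rw [hN n hn]; rfl)
  convert h using 1
  · funext τ
    simp only [dotProduct, Finset.sum_apply, Pi.mul_apply, twist]
    refine Finset.sum_congr rfl fun ξ _ => ?_
    have := qPow_neg_mul_self (Λ' ξ) τ
    rw [hneg]
    push_cast
    rw [neg_neg]
    linear_combination (-X τ ξ * Y τ ξ) * this
  · funext k
    simp only [dotProduct, Finset.sum_apply]
    rw [Finset.sum_comm]

/-- A holomorphic level one modular function vanishing at the cusp is zero. -/
theorem HasQSeries.eq_zero_of_levelOne {f : ℍ → ℂ} {a : ℤ → ℂ} (hf : HasQSeries f a)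
    (ha : ∀ n ≤ 0, a n = 0) (hmod : ∀ (γ : SL(2, ℤ)) (τ : ℍ), f (γ • τ) = f τ) : f = 0 := by
  have hslash : ∀ γ : SL(2, ℤ), SlashAction.map (0 : ℤ) γ f = f := fun γ => by
    funext τ
    rw [ModularForm.SL_slash_apply, hmod]
    simp
  have hbd : IsBoundedAtImInfty f := by
    have := hf.isBigO (N := 0) fun n hn => ha n hn.le
    refine this.trans (Asymptotics.isBigO_of_le _ fun τ => ?_)
    simp [qPow_zero]
  let F : ModularForm 𝒮ℒ 0 :=
    { toFun := f
      slash_action_eq' := fun _ ⟨γ, hγ⟩ => hγ ▸ hslash γ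
      holo' := hf.mdifferentiable.1
      bdd_at_cusps' := fun {c} hc => by
        rw [Subgroup.IsArithmetic.isCusp_iff_isCusp_SL2Z] at hc
        rw [OnePoint.isBoundedAt_iff_forall_SL2Z hc]
        intro γ _
        rw [hslash γ]
        exact hbd }
  obtain ⟨c, hc⟩ := ModularFormClass.levelOne_weight_zero_const F
  have hc' : f = fun _ => c := hc
  have h1 := hf.qCoeff_eq
  rw [hc', (hasQSeries_const c).qCoeff_eq] at h1
  have h2 := congrFun h1 0
  rw [ha 0 le_rfl, Pi.single_eq_same] at h2
  rw [hc', h2]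
  rfl

/-! ### Existence of a bijective exponent -/

theorem vecCoeff_of_principalPart_eq_single (hΛ : IsExponent ρ Λ) {X : modFun ρ} {m : ℕ+}
    {v : Fin d → ℂ} (hX : principalPart ρ Λ hΛ X = Finsupp.single m v) {n : ℤ} (hn : n < 0) :
    vecCoeff Λ X n = if n = -(m : ℤ) then v else 0 := by
  obtain ⟨k, hk⟩ : ∃ k : ℕ+, n = -(k : ℤ) := ⟨Nat.toPNat (-n).toNat (by lia), by
    rw [Nat.toPNat, PNat.mk_coe]
    lia⟩
  have h3 := DFunLike.congr_fun hX k
  rw [principalPart_apply, Finsupp.single_apply, ← hk] at h3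
  rw [h3, hk]
  congr 1
  rw [← PNat.coe_inj, eq_iff_iff]
  lia

/-- If X starts at order m + 2, pair it with Y having principal part q^(-(m+1)) e_ξ. The product
starts at order 1, so it is a level one function vanishing at the cusp, hence 0; its coefficient of
q is the ξ-component of X[m+2]. The threshold 2 is needed because the poles of Y have order at least
1. -/
theorem eq_zero_of_dual_surjective {Λ' : Fin d → ℚ} (hΛ : IsExponent ρ Λ)
    (hΛ' : IsExponent (dualRep ρ) Λ') (hneg : ∀ ξ, Λ ξ = -Λ' ξ)
    (hsurj : Function.Surjective (principalPart (dualRep ρ) Λ' hΛ')) {X : ℍ → Fin d → ℂ}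
    (hX : X ∈ modFun ρ) (h2 : ∀ n < 2, vecCoeff Λ X n = 0) : X = 0 := by
  refine eq_zero_of_vecCoeff_eq_zero hΛ hX fun n => ?_
  have key : ∀ m : ℕ, ∀ n < (m : ℤ) + 2, vecCoeff Λ X n = 0 := by
    intro m
    induction m with
    | zero => simpa using h2
    | succ m ih =>
      intro n hn
      rcases (show n < (m : ℤ) + 2 ∨ n = (m : ℤ) + 2 by push_cast at hn; lia) with h | rfl
      · exact ih n h
      funext ξ
      obtain ⟨Y, hY⟩ := hsurj (Finsupp.single (m.succPNat) (Pi.single ξ 1))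
      have hYc : ∀ n < 0, vecCoeff Λ' Y n = if n = -((m : ℤ) + 1) then Pi.single ξ 1 else 0 := by
        intro n hn
        rw [vecCoeff_of_principalPart_eq_single hΛ' hY hn, Nat.succPNat_coe]
        push_cast
        rfl
      have hq := hasQSeries_pairing hΛ hΛ' hneg hX Y.2 ih (N := -((m : ℤ) + 1)) fun n hn => by
        rw [hYc n (by lia), if_neg (by lia)]
      have hf := hq.eq_zero_of_levelOne (fun k hk => by
        rw [Finset.Icc_eq_empty (by lia), Finset.sum_empty]) (pairing_smul hX Y.2)
      rw [hf] at hq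
      have h1 := congrFun hq.eq_zero 1
      have e : (1 : ℤ) - -((m : ℤ) + 1) = (m : ℤ) + 2 := by ring
      simp only [e, Finset.Icc_self, Finset.sum_singleton, Pi.zero_apply] at h1
      rw [hYc _ (by lia), if_pos (by lia), dotProduct_single, mul_one] at h1
      exact h1
  exact key n.toNat n (by lia)

theorem finiteDimensional_ker_principalPart {Λ' : Fin d → ℚ} (hΛ : IsExponent ρ Λ)
    (hΛ' : IsExponent (dualRep ρ) Λ')
    (hsurj : Function.Surjective (principalPart (dualRep ρ) Λ' hΛ')) :
    FiniteDimensional ℂ (LinearMap.ker (principalPart ρ Λ hΛ)) := by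
  have hΛ₁ : IsExponent ρ (-Λ') := by
    obtain ⟨k, hk⟩ := hΛ.dualRep.exists_int hΛ'
    refine hΛ.add_int (k := -k) fun ξ => ?_
    rw [Pi.neg_apply, hk]
    push_cast [Pi.neg_apply]
    ring
  obtain ⟨k, hk⟩ := hΛ.exists_int hΛ₁
  -- Vanishing below order 2 relative to -Λ' means vanishing below order 2 + k relative to Λ. A
  -- kernel element has no negative coefficients, so its coefficients of index 0, …, L - 1 determine
  -- it.
  obtain ⟨L, hL⟩ : ∃ L : ℕ, ∀ ξ, 2 + k ξ ≤ L := by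
    refine ⟨∑ ξ, (2 + k ξ).toNat, fun ξ => (Int.self_le_toNat _).trans ?_⟩
    exact_mod_cast Finset.single_le_sum (f := fun ξ => (2 + k ξ).toNat)
      (fun _ _ => Nat.zero_le _) (Finset.mem_univ ξ)
  let φ : LinearMap.ker (principalPart ρ Λ hΛ) →ₗ[ℂ] (Fin L × Fin d → ℂ) :=
    LinearMap.pi fun j => LinearMap.proj j.2 ∘ₗ vecCoeffL hΛ (j.1 : ℤ) ∘ₗ Submodule.subtype _
  suffices hφ : ∀ X, φ X = 0 → X = 0 from
    FiniteDimensional.of_injective φ fun X Y h => sub_eq_zero.mp (hφ _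
      ((LinearMap.map_sub φ X Y).trans (sub_eq_zero.mpr h)))
  rintro ⟨X, hX⟩ h
  have hneg := (principalPart_eq_zero_iff hΛ X).mp hX
  have hX0 : (X : ℍ → Fin d → ℂ) = 0 := by
    refine eq_zero_of_dual_surjective hΛ₁ hΛ' (fun ξ => rfl) hsurj X.2 fun n hn => ?_
    funext ξ
    rw [vecCoeff_shift hΛ X.2 (hk ξ)]
    rcases lt_or_ge (n + k ξ) 0 with h0 | h0
    · rw [hneg _ h0]
    · have h1 := congrFun h (⟨(n + k ξ).toNat, by have := hL ξ; lia⟩, ξ)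
      have h2 : vecCoeff Λ X (((n + k ξ).toNat : ℕ) : ℤ) ξ = 0 := h1
      rw [show (((n + k ξ).toNat : ℕ) : ℤ) = n + k ξ by lia] at h2
      rw [h2, Pi.zero_apply]
  ext1
  ext1
  exact hX0

/-- If every kernel element had zero constant term, J would map the kernel to itself, since its pole
is simple. Multiplying by J lowers the order of vanishing by one, so vanishing of X[m] throughout
the kernel would propagate to X[m+1], and the kernel would be zero. -/
theorem exists_vecCoeff_zero_ne (hΛ : IsExponent ρ Λ)
    (h : LinearMap.ker (principalPart ρ Λ hΛ) ≠ ⊥) :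
    ∃ X ∈ LinearMap.ker (principalPart ρ Λ hΛ), ∃ ξ, vecCoeff Λ X 0 ξ ≠ 0 := by
  by_contra! hcon
  refine h ((Submodule.eq_bot_iff _).mpr fun X hX => ?_)
  have key : ∀ m : ℕ, ∀ X ∈ LinearMap.ker (principalPart ρ Λ hΛ), vecCoeff Λ X m = 0 := by
    intro m
    induction m using Nat.strong_induction_on with
    | _ m ih =>
      intro X hX
      rcases m with _ | m
      · exact funext (hcon X hX)
      have hlow : ∀ n < (m : ℤ) + 1, vecCoeff Λ X n = 0 := by
        intro n hn
        rcases lt_or_ge n 0 with h0 | h0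
        · exact (principalPart_eq_zero_iff hΛ X).mp hX n h0
        · have := ih n.toNat (by lia) X hX
          rwa [Int.toNat_of_nonneg h0] at this
      have hJ := hasLead_hauptmodul.vecCoeff_smul hΛ X.2 hlow
      have hJX := hauptmodul_smul_mem hΛ X.2
      have h1 := ih m (by lia) ⟨_, hJX⟩ ((principalPart_eq_zero_iff hΛ ⟨_, hJX⟩).mpr fun n hn => by
        rw [hJ n, Finset.Icc_eq_empty (by lia), Finset.sum_empty])
      dsimp only at h1
      rw [hJ m, show (m : ℤ) - (m + 1) = -1 by ring, Finset.Icc_self, Finset.sum_singleton,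
        hasLead_hauptmodul.coeff_eq.2.2.1, one_smul, sub_neg_eq_add] at h1
      exact_mod_cast h1
  ext1
  refine eq_zero_of_vecCoeff_eq_zero hΛ X.2 fun n => ?_
  rcases lt_or_ge n 0 with h0 | h0
  · exact (principalPart_eq_zero_iff hΛ X).mp hX n h0
  · have := key n.toNat X hX
    rwa [Int.toNat_of_nonneg h0] at this

/-- Raising one entry Λ_ξ₀ by 1 enlarges the principal part by the constant term of the
ξ₀-component. A kernel element X₀ with nonzero constant term there can adjust this extra coefficient
freely, and it leaves the kernel. -/
theorem exists_surjective_ker_lt (hΛ : IsExponent ρ Λ)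
    (hsurj : Function.Surjective (principalPart ρ Λ hΛ))
    (h : LinearMap.ker (principalPart ρ Λ hΛ) ≠ ⊥) :
    ∃ (Λ' : Fin d → ℚ) (hΛ' : IsExponent ρ Λ'), Function.Surjective (principalPart ρ Λ' hΛ') ∧
      LinearMap.ker (principalPart ρ Λ' hΛ') < LinearMap.ker (principalPart ρ Λ hΛ) := by
  obtain ⟨X₀, hX₀, ξ₀, hξ₀⟩ := exists_vecCoeff_zero_ne hΛ h
  have hX₀' := (principalPart_eq_zero_iff hΛ X₀).mp hX₀
  set k : Fin d → ℤ := Pi.single ξ₀ 1 with hk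
  have hΛ' : IsExponent ρ (fun ξ => Λ ξ + k ξ) := hΛ.add_int fun ξ => rfl
  have hshift : ∀ (X : modFun ρ) n ξ, vecCoeff (fun ξ => Λ ξ + k ξ) X n ξ =
      vecCoeff Λ X (n + k ξ) ξ := fun X n ξ => vecCoeff_shift hΛ X.2 rfl n
  refine ⟨_, hΛ', fun p => ?_, lt_of_le_of_ne (fun X hX => ?_) fun heq => ?_⟩
  -- The target p is translated back to the old exponent: components other than ξ₀ are kept, and the
  -- ξ₀-component is shifted by one place. Its lost coefficient p 1 ξ₀ is restored by adding c • X₀.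
  · let f₀ : (Fin d → ℂ) → (Fin d → ℂ) := fun v ξ => if ξ = ξ₀ then 0 else v ξ
    let f₁ : (Fin d → ℂ) → (Fin d → ℂ) := fun v ξ => if ξ = ξ₀ then v ξ else 0
    obtain ⟨Z, hZ⟩ := hsurj (Finsupp.mapRange f₀ (by funext ξ; simp [f₀]) p +
      Finsupp.mapRange f₁ (by funext ξ; simp [f₁])
        (Finsupp.comapDomain (fun n : ℕ+ => n + 1) p (add_left_injective 1).injOn))
    have hZn : ∀ n : ℕ+, vecCoeff Λ Z (-(n : ℤ)) = f₀ (p n) + f₁ (p (n + 1)) := fun n =>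
      DFunLike.congr_fun hZ n
    set c : ℂ := (p 1 ξ₀ - vecCoeff Λ Z 0 ξ₀) / vecCoeff Λ X₀ 0 ξ₀ with hc
    refine ⟨Z + c • X₀, ?_⟩
    ext n ξ
    rw [principalPart_apply, hshift]
    have hlin : ∀ m, vecCoeff Λ ((Z + c • X₀ : modFun ρ) : ℍ → Fin d → ℂ) m =
        vecCoeff Λ Z m + c • vecCoeff Λ X₀ m := fun m => by
      simpa using (vecCoeffL hΛ m).map_add Z (c • X₀)
    rw [hlin]
    by_cases hξ : ξ = ξ₀
    · subst hξ
      have hkξ : k ξ = 1 := by simp [hk]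
      rw [hkξ]
      by_cases hn : n = 1
      · subst hn
        simp only [PNat.one_coe, Nat.cast_one, neg_add_cancel, Pi.add_apply, Pi.smul_apply,
          smul_eq_mul, hc]
        field_simp
        ring
      · obtain ⟨m, rfl⟩ := PNat.exists_eq_succ_of_ne_one hn
        have e : -((m + 1 : ℕ+) : ℤ) + 1 = -(m : ℤ) := by
          push_cast
          ring
        rw [e, hZn, hX₀' _ (by have := m.pos; lia)]
        simp [f₀, f₁]
    · have hkξ : k ξ = 0 := by simp [hk, hξ]
      rw [hkξ, add_zero, hZn, hX₀' _ (by have := n.pos; lia)]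
      simp [f₀, f₁, hξ]
  · rw [LinearMap.mem_ker, principalPart_eq_zero_iff] at hX ⊢
    intro n hn
    funext ξ
    have h1 := congrFun (hX (n - k ξ) (by
      have : 0 ≤ k ξ := by
        by_cases hξ : ξ = ξ₀
        · subst hξ; simp [hk]
        · simp [hk, hξ]
      lia)) ξ
    rw [hshift] at h1
    simpa using h1
  · rw [← heq, LinearMap.mem_ker, principalPart_eq_zero_iff] at hX₀
    have h1 := congrFun (hX₀ (-1) (by norm_num)) ξ₀
    rw [hshift] at h1
    exact hξ₀ (by simpa [hk] using h1)

theorem exists_bijective_principalPart {Λ' : Fin d → ℚ} (hΛ : IsExponent ρ Λ)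
    (hΛ' : IsExponent (dualRep ρ) Λ') (hsurj : Function.Surjective (principalPart ρ Λ hΛ))
    (hsurj' : Function.Surjective (principalPart (dualRep ρ) Λ' hΛ')) :
    ∃ (Λ : Fin d → ℚ) (hΛ : IsExponent ρ Λ), Function.Bijective (principalPart ρ Λ hΛ) := by
  induction hn : Module.finrank ℂ (LinearMap.ker (principalPart ρ Λ hΛ)) using
    Nat.strong_induction_on generalizing Λ with
  | _ n ih =>
    by_cases hker : LinearMap.ker (principalPart ρ Λ hΛ) = ⊥
    · exact ⟨Λ, hΛ, LinearMap.ker_eq_bot.mp hker, hsurj⟩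
    · obtain ⟨Λ₁, hΛ₁, hs, hlt⟩ := exists_surjective_ker_lt hΛ hsurj hker
      have := finiteDimensional_ker_principalPart hΛ hΛ' hsurj'
      exact ih _ (hn ▸ Submodule.finrank_lt_finrank_of_lt hlt) hΛ₁ hs rfl

end

section

/-! ### The canonical basis -/

variable {d : ℕ} {ρ : SL(2, ℤ) →* GL (Fin d) ℂ} {Λ : Fin d → ℚ}

/-- The monomials `q ^ (-n) e_ξ` form a basis of the space of principal parts. -/
def principalBasis (d : ℕ) : Module.Basis (Fin d × ℕ+) ℂ (ℕ+ →₀ (Fin d → ℂ)) :=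
  (Finsupp.basis fun _ : ℕ+ => Pi.basisFun ℂ (Fin d)).reindex
    ((Equiv.sigmaEquivProd _ _).trans (Equiv.prodComm _ _))

theorem principalBasis_apply (p : Fin d × ℕ+) :
    principalBasis d p = Finsupp.single p.2 (Pi.single p.1 1) := by
  simp [principalBasis]

/-- The canonical basis attached to a bijective exponent. -/
def canonicalBasis (hΛ : IsExponent ρ Λ) (hb : Function.Bijective (principalPart ρ Λ hΛ)) :
    Module.Basis (Fin d × ℕ+) ℂ (modFun ρ) :=
  (principalBasis d).map (LinearEquiv.ofBijective (principalPart ρ Λ hΛ) hb).symm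

theorem isCanonicalBasis_canonicalBasis (hΛ : IsExponent ρ Λ)
    (hb : Function.Bijective (principalPart ρ Λ hΛ)) :
    IsCanonicalBasis hΛ fun ξ n => canonicalBasis hΛ hb (ξ, n) := by
  intro ξ n
  change principalPart ρ Λ hΛ (canonicalBasis hΛ hb (ξ, n)) = _
  rw [canonicalBasis, Module.Basis.map_apply, principalBasis_apply]
  exact LinearEquiv.apply_symm_apply (LinearEquiv.ofBijective (principalPart ρ Λ hΛ) hb) _

variable {B : Fin d → ℕ+ → modFun ρ}

theorem IsCanonicalBasis.vecCoeff_neg {hΛ : IsExponent ρ Λ} (hB : IsCanonicalBasis hΛ B)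
    (ξ : Fin d) (m : ℕ+) {n : ℤ} (hn : n < 0) :
    vecCoeff Λ (B ξ m) n = if n = -(m : ℤ) then Pi.single ξ 1 else 0 :=
  vecCoeff_of_principalPart_eq_single hΛ (hB ξ m) hn

theorem IsCanonicalBasis.vecCoeff_lt {hΛ : IsExponent ρ Λ} (hB : IsCanonicalBasis hΛ B)
    (ξ : Fin d) (m : ℕ+) {n : ℤ} (hn : n < -(m : ℤ)) : vecCoeff Λ (B ξ m) n = 0 := by
  rw [hB.vecCoeff_neg ξ m (by have := m.pos; lia), if_neg (by lia)]

/-- The principle behind the recurrence and the differential equation: only finitely many polar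
coefficients have to be compared. -/
theorem eq_of_vecCoeff_neg_eq (hΛ : IsExponent ρ Λ)
    (hb : Function.Injective (principalPart ρ Λ hΛ)) {X Y : modFun ρ}
    (h : ∀ n : ℕ+, vecCoeff Λ X (-(n : ℤ)) = vecCoeff Λ Y (-(n : ℤ))) : X = Y :=
  hb (Finsupp.ext h)

theorem jCoeff_neg_one : jCoeff (-1) = 1 := hasLead_hauptmodul.coeff_eq.2.2.1

theorem jCoeff_zero : jCoeff 0 = 0 := hasLead_hauptmodul.coeff_eq.2.2.2

theorem jCoeff_lt {n : ℤ} (hn : n < -1) : jCoeff n = 0 := hasLead_hauptmodul.coeff_eq.2.1 n hn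

/-- As the pole of J is simple, only two terms of the canonical vector affect the polar part of the
product: its own pole q^(-m), multiplied by all of J, and its constant term, which q⁻¹ moves to q⁻¹.
-/
theorem IsCanonicalBasis.vecCoeff_hauptmodul_smul {hΛ : IsExponent ρ Λ}
    (hB : IsCanonicalBasis hΛ B) (ξ : Fin d) (m k : ℕ+) :
    vecCoeff Λ (hauptmodul • (B ξ m : ℍ → Fin d → ℂ)) (-(k : ℤ)) =
      jCoeff (m - k) • Pi.single ξ 1 + if k = 1 then vecCoeff Λ (B ξ m) 0 else 0 := by
  have hm := m.pos
  have hk := k.pos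
  rw [hasLead_hauptmodul.vecCoeff_smul hΛ (B ξ m).2 (fun n hn => hB.vecCoeff_lt ξ m hn)]
  have hterm : ∀ j ∈ Finset.Icc (-1 : ℤ) (-(k : ℤ) - -(m : ℤ)),
      qCoeff hauptmodul j • vecCoeff Λ (B ξ m) (-(k : ℤ) - j) =
      (if j = (m : ℤ) - k then jCoeff (m - k) • Pi.single ξ 1 else 0) +
        if j = -1 then (if k = 1 then vecCoeff Λ (B ξ m) 0 else 0) else 0 := by
    intro j hj
    rw [Finset.mem_Icc] at hj
    rcases lt_or_ge (-(k : ℤ) - j) 0 with h | h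
    · rw [hB.vecCoeff_neg ξ m h]
      have h1 : ¬(j = -1 ∧ k = 1) := by
        rintro ⟨rfl, rfl⟩
        simp at h
      have h2 : (if j = -1 then (if k = 1 then vecCoeff Λ (B ξ m) 0 else 0) else 0) = 0 := by
        rw [← ite_and, if_neg h1]
      rw [h2, add_zero]
      by_cases hjm : j = (m : ℤ) - k
      · rw [if_pos (by lia), if_pos hjm, hjm]
        rfl
      · rw [if_neg (by lia), if_neg hjm, smul_zero]
    · have hj1 : j = -1 := by lia
      have hk1 : k = 1 := by
        rw [← PNat.coe_inj, PNat.one_coe]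
        lia
      subst hj1 hk1
      rw [if_neg (by push_cast; lia), zero_add, if_pos rfl, if_pos rfl,
        hasLead_hauptmodul.coeff_eq.2.2.1, one_smul]
      simp
  rw [Finset.sum_congr rfl hterm, Finset.sum_add_distrib, Finset.sum_ite_eq', Finset.sum_ite_eq']
  congr 1
  · split_ifs with h
    · rfl
    · rw [Finset.mem_Icc] at h
      rw [jCoeff_lt (by lia), zero_smul]
  · by_cases hk1 : k = 1
    · rw [if_pos]
      rw [Finset.mem_Icc, hk1]
      push_cast
      lia
    · simp [hk1]

theorem IsCanonicalBasis.recurrence {hΛ : IsExponent ρ Λ} (hB : IsCanonicalBasis hΛ B)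
    (hb : Function.Injective (principalPart ρ Λ hΛ)) (ξ : Fin d) (m : ℕ+) :
    B ξ (m + 1) = ⟨_, hauptmodul_smul_mem hΛ (B ξ m).2⟩
      - ∑ n ∈ Finset.Ico 1 m, jCoeff n • B ξ (m - n)
      - ∑ η, vecCoeff Λ (B ξ m) 0 η • B η 1 := by
  refine eq_of_vecCoeff_neg_eq hΛ hb fun k => ?_
  have hk := k.pos
  rw [← vecCoeffL_apply hΛ, ← vecCoeffL_apply hΛ, map_sub, map_sub, map_sum, map_sum]
  simp only [map_smul, vecCoeffL_apply]
  rw [hB.vecCoeff_hauptmodul_smul,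
    hB.vecCoeff_neg ξ (m + 1) (show -(k : ℤ) < 0 by lia)]
  have h1 : ∀ η, vecCoeff Λ (B ξ m) 0 η • vecCoeff Λ (B η 1) (-(k : ℤ)) =
      if k = 1 then vecCoeff Λ (B ξ m) 0 η • (Pi.single η 1 : Fin d → ℂ) else 0 := fun η => by
    rw [hB.vecCoeff_neg η 1 (show -(k : ℤ) < 0 by lia)]
    have : -(k : ℤ) = -(((1 : ℕ+) : ℕ) : ℤ) ↔ k = 1 := by
      rw [← PNat.coe_inj, PNat.one_coe]
      lia
    rw [if_congr this rfl rfl]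
    split_ifs <;> simp
  have h2 : ∀ n ∈ Finset.Ico 1 m, jCoeff n • vecCoeff Λ (B ξ (m - n)) (-(k : ℤ)) =
      if m = k + n then jCoeff (m - k) • (Pi.single ξ 1 : Fin d → ℂ) else 0 := fun n hn => by
    rw [Finset.mem_Ico] at hn
    -- Subtraction in `ℕ+` is truncated at 1; the range n < m makes it genuine.
    have hsub : ((m - n : ℕ+) : ℕ) = m - n := by rw [PNat.sub_coe, if_pos hn.2]
    have hnm : (n : ℕ) < m := hn.2
    rw [hB.vecCoeff_neg ξ (m - n) (show -(k : ℤ) < 0 by lia), hsub]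
    have : -(k : ℤ) = -((m - n : ℕ) : ℤ) ↔ m = k + n := by
      rw [← PNat.coe_inj, PNat.add_coe]
      lia
    rw [if_congr this rfl rfl]
    split_ifs with h
    · congr 2
      rw [h]
      push_cast
      ring
    · simp
  rw [Finset.sum_congr rfl h2, Finset.sum_congr rfl fun η _ => h1 η]
  have h3 : (∑ η, if k = 1 then vecCoeff Λ (B ξ m) 0 η • (Pi.single η 1 : Fin d → ℂ) else 0) =
      if k = 1 then vecCoeff Λ (B ξ m) 0 else 0 := by
    split_ifs
    · conv_rhs => rw [pi_eq_sum_univ' (vecCoeff Λ (B ξ m) 0)]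
    · simp
  rw [h3]
  have h4 : ∑ n ∈ Finset.Ico 1 m,
      (if m = k + n then jCoeff (m - k) • (Pi.single ξ 1 : Fin d → ℂ) else 0) =
      if k < m then jCoeff (m - k) • (Pi.single ξ 1 : Fin d → ℂ) else 0 := by
    by_cases hkm : k < m
    · have hkm' : (k : ℕ) < m := hkm
      rw [if_pos hkm, Finset.sum_eq_single (m - k), if_pos]
      · rw [← PNat.coe_inj, PNat.add_coe, PNat.sub_coe, if_pos hkm]
        lia
      · intro n _ hn
        rw [if_neg]
        rintro rfl
        exact hn (by rw [add_comm, PNat.add_sub])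
      · intro h
        exfalso
        apply h
        rw [Finset.mem_Ico]
        refine ⟨one_le, ?_⟩
        rw [← PNat.coe_lt_coe, PNat.sub_coe, if_pos hkm]
        lia
    · rw [if_neg hkm]
      refine Finset.sum_eq_zero fun n _ => if_neg ?_
      rintro rfl
      exact hkm (PNat.lt_add_right k n)
  rw [h4]
  have hcast : k < m ↔ (k : ℤ) < m := by
    rw [← PNat.coe_lt_coe]
    lia
  have hcast' : -(k : ℤ) = -((m + 1 : ℕ+) : ℤ) ↔ (k : ℤ) = m + 1 := by
    rw [PNat.add_coe, PNat.one_coe]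
    push_cast
    lia
  rw [if_congr hcast rfl rfl, if_congr hcast' rfl rfl]
  -- The coefficients c(m - k) with k < m are removed by the sum, the case k = m contributes c(0) =
  -- 0, and k = m + 1 gives the new leading term from c(-1) = 1.
  rcases lt_trichotomy (k : ℤ) m with h | h | h
  · rw [if_pos h, if_neg (show ¬(k : ℤ) = m + 1 by lia)]
    abel
  · rw [if_neg (show ¬(k : ℤ) < m by lia), if_neg (show ¬(k : ℤ) = m + 1 by lia), h, sub_self,
      jCoeff_zero]
    simp
  · rw [if_neg (show ¬(k : ℤ) < m by lia)]
    by_cases h5 : (k : ℤ) = m + 1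
    · rw [if_pos h5, h5, show (m : ℤ) - (m + 1) = -1 by ring, jCoeff_neg_one]
      simp
    · rw [if_neg h5, jCoeff_lt (show (m : ℤ) - k < -1 by lia)]
      simp

end

section

open Polynomial

/-! ### The module structure over `ℂ[J]` -/

variable {d : ℕ} {ρ : SL(2, ℤ) →* GL (Fin d) ℂ} {Λ : Fin d → ℚ} {B : Fin d → ℕ+ → modFun ρ}

theorem smul_mem_modFun_of_mem_adjoin (hΛ : IsExponent ρ Λ) {f : ℍ → ℂ} (hf : f ∈ CJ)
    {X : ℍ → Fin d → ℂ} (hX : X ∈ modFun ρ) : f • X ∈ modFun ρ := by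
  induction hf using Algebra.adjoin_induction generalizing X with
  | mem f hf =>
    rw [Set.mem_singleton_iff.mp hf]
    exact hauptmodul_smul_mem hΛ hX
  | algebraMap c =>
    rw [algebraMap_smul]
    exact (modFun ρ).smul_mem c hX
  | add f g _ _ h1 h2 =>
    rw [add_smul]
    exact (modFun ρ).add_mem (h1 hX) (h2 hX)
  | mul f g _ _ h1 h2 =>
    rw [mul_smul]
    exact h1 (h2 hX)

theorem hauptmodul_pow_smul (hΛ : IsExponent ρ Λ) {X : ℍ → Fin d → ℂ} (hX : X ∈ modFun ρ)
    {N : ℤ} (hN : ∀ n < N, vecCoeff Λ X n = 0) (i : ℕ) :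
    hauptmodul ^ i • X ∈ modFun ρ ∧ (∀ n < N - i, vecCoeff Λ (hauptmodul ^ i • X) n = 0) ∧
      vecCoeff Λ (hauptmodul ^ i • X) (N - i) = vecCoeff Λ X N := by
  induction i with
  | zero => simpa [hX] using hN
  | succ i ih =>
    obtain ⟨h1, h2, h3⟩ := ih
    rw [pow_succ', mul_smul]
    have h4 := hasLead_hauptmodul.vecCoeff_smul hΛ h1 h2
    refine ⟨hauptmodul_smul_mem hΛ h1, fun n hn => ?_, ?_⟩
    · rw [h4, Finset.Icc_eq_empty (by push_cast at hn; lia), Finset.sum_empty]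
    · rw [h4, show N - ((i + 1 : ℕ) : ℤ) - (N - i) = -1 by push_cast; ring, Finset.Icc_self,
        Finset.sum_singleton, hasLead_hauptmodul.coeff_eq.2.2.1, one_smul,
        show N - ((i + 1 : ℕ) : ℤ) - -1 = N - i by push_cast; ring, h3]

/-- Since J^i X has order N - i with the same leading coefficient as X, only the monomial of degree
D reaches order N - D. -/
theorem vecCoeff_aeval_smul (hΛ : IsExponent ρ Λ) {X : ℍ → Fin d → ℂ} (hX : X ∈ modFun ρ)
    {N : ℤ} (hN : ∀ n < N, vecCoeff Λ X n = 0) {p : ℂ[X]} {D : ℕ} (hp : p.natDegree ≤ D) :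
    vecCoeff Λ (aeval hauptmodul p • X) (N - D) = p.coeff D • vecCoeff Λ X N := by
  have h1 : aeval hauptmodul p • X =
      ((∑ i ∈ Finset.range (D + 1), p.coeff i • ⟨_, (hauptmodul_pow_smul hΛ hX hN i).1⟩ :
        modFun ρ) : ℍ → Fin d → ℂ) := by
    rw [aeval_eq_sum_range' (Nat.lt_succ_of_le hp), Finset.sum_smul]
    simp
  rw [h1, ← vecCoeffL_apply hΛ, map_sum, Finset.sum_eq_single D]
  · rw [map_smul, vecCoeffL_apply, (hauptmodul_pow_smul hΛ hX hN D).2.2]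
  · intro i hi hiD
    rw [Finset.mem_range] at hi
    rw [map_smul, vecCoeffL_apply, (hauptmodul_pow_smul hΛ hX hN i).2.1 _ (by lia), smul_zero]
  · simp

theorem IsCanonicalBasis.linearIndependent_adjoin {hΛ : IsExponent ρ Λ}
    (hB : IsCanonicalBasis hΛ B) :
    LinearIndependent CJ (fun η => (B η 1 : ℍ → Fin d → ℂ)) := by
  rw [Fintype.linearIndependent_iff]
  intro g hg
  have hp : ∀ η, ∃ p : ℂ[X], aeval hauptmodul p = (g η : ℍ → ℂ) := fun η => by
    have : (g η : ℍ → ℂ) ∈ Algebra.adjoin ℂ {hauptmodul} := (g η).2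
    rwa [Algebra.adjoin_singleton_eq_range_aeval] at this
  choose p hp using hp
  suffices h : ∀ η, p η = 0 by
    intro η
    ext1
    rw [← hp, h, map_zero]
    rfl
  -- The leading vectors of the generators are the unit vectors at q⁻¹. Hence the coefficient of
  -- q^(-1-D) in the relation is the vector of all degree D coefficients.
  have key : ∀ D, (∀ η, (p η).natDegree ≤ D) → ∀ η, (p η).coeff D = 0 := by
    intro D hD
    have h1 : (∑ η, ⟨_, smul_mem_modFun_of_mem_adjoin hΛ (g η).2 (B η 1).2⟩ : modFun ρ) = 0 := by
      ext1
      rw [Submodule.coe_sum]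
      exact hg
    have h2 := congrArg (vecCoeffL hΛ (-1 - D)) h1
    rw [map_sum, map_zero] at h2
    have h3 : ∀ η, vecCoeffL hΛ (-1 - D)
        ⟨_, smul_mem_modFun_of_mem_adjoin hΛ (g η).2 (B η 1).2⟩ =
        (p η).coeff D • (Pi.single η 1 : Fin d → ℂ) := fun η => by
      rw [vecCoeffL_apply]
      change vecCoeff Λ ((g η : ℍ → ℂ) • (B η 1 : ℍ → Fin d → ℂ)) _ = _
      rw [← hp, vecCoeff_aeval_smul hΛ (B η 1).2 (N := -1)
        (fun n hn => hB.vecCoeff_lt η 1 (by simpa using hn)) (hD η),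
        hB.vecCoeff_neg η 1 (by simp), if_pos (by simp)]
    rw [Finset.sum_congr rfl fun η _ => h3 η] at h2
    intro ζ
    simpa [Finset.sum_apply, Pi.single_apply] using congrFun h2 ζ
  by_contra! h
  obtain ⟨η, hη⟩ := h
  -- A polynomial attaining the maximal degree has zero leading coefficient, so it vanishes. Thus D
  -- = 0, all p η are constants, and these are zero by `key`.
  set D := Finset.univ.sup fun η => (p η).natDegree with hD
  have hle : ∀ η, (p η).natDegree ≤ D := fun η =>
    Finset.le_sup (f := fun η => (p η).natDegree) (Finset.mem_univ η)
  obtain ⟨ζ, -, hζ⟩ := Finset.exists_mem_eq_sup Finset.univ ⟨η, Finset.mem_univ η⟩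
    fun η => (p η).natDegree
  have h1 := key D hle
  have h2 : p ζ = 0 := by
    rw [← leadingCoeff_eq_zero, leadingCoeff, ← hζ]
    exact h1 ζ
  have h3 : D = 0 := by rw [hD, hζ, h2, natDegree_zero]
  apply hη
  rw [eq_C_of_natDegree_eq_zero (le_antisymm ((hle η).trans h3.le) (Nat.zero_le _))]
  rw [h3] at h1
  rw [h1, map_zero]

theorem IsCanonicalBasis.span_eq_top {hΛ : IsExponent ρ Λ} (hB : IsCanonicalBasis hΛ B)
    (hb : Function.Bijective (principalPart ρ Λ hΛ)) :
    LinearIndependent ℂ (fun p : Fin d × ℕ+ => B p.1 p.2) ∧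
      Submodule.span ℂ (Set.range fun p : Fin d × ℕ+ => B p.1 p.2) = ⊤ := by
  have : (fun p : Fin d × ℕ+ => B p.1 p.2) = canonicalBasis hΛ hb := by
    funext p
    exact hb.1 ((hB p.1 p.2).trans (isCanonicalBasis_canonicalBasis hΛ hb p.1 p.2).symm)
  rw [this]
  exact ⟨(canonicalBasis hΛ hb).linearIndependent, (canonicalBasis hΛ hb).span_eq⟩

/-- The recurrence expresses each canonical vector through J times the previous one and vectors with
poles of smaller order, so strong induction reduces everything to simple poles. -/
theorem IsCanonicalBasis.mem_span_adjoin {hΛ : IsExponent ρ Λ} (hB : IsCanonicalBasis hΛ B)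
    (hb : Function.Injective (principalPart ρ Λ hΛ)) (ξ : Fin d) (m : ℕ+) :
    (B ξ m : ℍ → Fin d → ℂ) ∈
      Submodule.span CJ (Set.range fun η => (B η 1 : ℍ → Fin d → ℂ)) := by
  have h1 : ∀ η, (B η 1 : ℍ → Fin d → ℂ) ∈
      Submodule.span CJ (Set.range fun η => (B η 1 : ℍ → Fin d → ℂ)) := fun η =>
    Submodule.subset_span ⟨η, rfl⟩
  have hc : ∀ (c : ℂ) {X : ℍ → Fin d → ℂ},
      X ∈ Submodule.span CJ (Set.range fun η => (B η 1 : ℍ → Fin d → ℂ)) →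
      c • X ∈ Submodule.span CJ (Set.range fun η => (B η 1 : ℍ → Fin d → ℂ)) := fun c X hX =>
    Submodule.smul_of_tower_mem _ c hX
  induction m using PNat.strongInductionOn with
  | _ m ih =>
    rcases eq_or_ne m 1 with rfl | hm
    · exact h1 ξ
    · obtain ⟨k, rfl⟩ := PNat.exists_eq_succ_of_ne_one hm
      have h2 := congrArg (Subtype.val : modFun ρ → ℍ → Fin d → ℂ) (hB.recurrence hb ξ k)
      rw [h2]
      push_cast
      refine sub_mem (sub_mem ?_ (sum_mem fun n hn => hc _ (ih _ ?_)))
        (sum_mem fun η _ => hc _ (h1 η))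
      · exact Submodule.smul_mem _ (⟨hauptmodul, Algebra.subset_adjoin rfl⟩ : CJ)
          (ih k (PNat.lt_add_right k 1))
      · rw [Finset.mem_Ico] at hn
        rw [← PNat.coe_lt_coe, PNat.sub_coe, if_pos hn.2, PNat.add_coe]
        have := k.pos
        have := n.pos
        lia

theorem IsCanonicalBasis.span_adjoin_eq {hΛ : IsExponent ρ Λ} (hB : IsCanonicalBasis hΛ B)
    (hb : Function.Bijective (principalPart ρ Λ hΛ)) :
    (Submodule.span CJ (Set.range fun η => (B η 1 : ℍ → Fin d → ℂ))).restrictScalars ℂ =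
      modFun ρ := by
  apply le_antisymm
  · intro X hX
    rw [Submodule.restrictScalars_mem] at hX
    induction hX using Submodule.span_induction with
    | mem X hX =>
      obtain ⟨η, rfl⟩ := hX
      exact (B η 1).2
    | zero => exact (modFun ρ).zero_mem
    | add X Y _ _ h1 h2 => exact (modFun ρ).add_mem h1 h2
    | smul f X _ h => exact smul_mem_modFun_of_mem_adjoin hΛ f.2 h
  · intro X hX
    have h1 : (⟨X, hX⟩ : modFun ρ) ∈
        Submodule.span ℂ (Set.range fun p : Fin d × ℕ+ => B p.1 p.2) := by
      rw [(hB.span_eq_top hb).2]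
      trivial
    have h2 : Submodule.span ℂ (Set.range fun p : Fin d × ℕ+ => B p.1 p.2) ≤
        ((Submodule.span CJ (Set.range fun η => (B η 1 : ℍ → Fin d → ℂ))).restrictScalars
          ℂ).comap (modFun ρ).subtype := by
      rw [Submodule.span_le]
      rintro _ ⟨p, rfl⟩
      exact hB.mem_span_adjoin hb.1 p.1 p.2
    exact h2 h1

theorem exists_free_adjoin (hΛ : IsExponent ρ Λ)
    (hb : Function.Bijective (principalPart ρ Λ hΛ)) :
    ∃ N : Submodule CJ (ℍ → Fin d → ℂ), N.restrictScalars ℂ = modFun ρ ∧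
      Module.Free CJ N ∧ Module.rank CJ N = d := by
  have hB := isCanonicalBasis_canonicalBasis hΛ hb
  have b := Module.Basis.span hB.linearIndependent_adjoin
  have : Nontrivial CJ := inferInstance
  refine ⟨_, hB.span_adjoin_eq hb, Module.Free.of_basis b, ?_⟩
  rw [rank_eq_card_basis b, Fintype.card_fin]

/-! ### The fundamental matrix -/

theorem IsCanonicalBasis.isBigO_fundamentalMatrix {hΛ : IsExponent ρ Λ}
    (hB : IsCanonicalBasis hΛ B) (ξ η : Fin d) :
    (fun τ => qPow (1 - (Λ ξ : ℂ)) τ * fundamentalMatrix B τ ξ η - (if ξ = η then 1 else 0))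
      =O[atImInfty] qPow 1 := by
  have h1 := ((hasQSeries_of_mem hΛ (B η 1).2 ξ).qPow_mul 1).sub
    (hasQSeries_const (if ξ = η then 1 else 0))
  have h2 := h1.isBigO (N := 1) fun n hn => ?_
  · convert h2 using 1
    · funext τ
      simp only [Pi.sub_apply, twist, fundamentalMatrix, Matrix.of_apply]
      rw [sub_eq_add_neg 1 (Λ ξ : ℂ), qPow_add]
      push_cast
      ring
    · simp
  · rw [Pi.sub_apply]
    rcases lt_or_eq_of_le (show n ≤ 0 by lia) with h | rfl
    · rw [hB.vecCoeff_lt η 1 (by push_cast; lia), Pi.single_eq_of_ne h.ne]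
      simp
    · rw [hB.vecCoeff_neg η 1 (by lia), if_pos (by simp)]
      simp [Pi.single_apply]

theorem tendsto_qPow_one : Tendsto (qPow 1) atImInfty (𝓝 0) := by
  rw [tendsto_zero_iff_norm_tendsto_zero]
  have h : ∀ τ, ‖qPow 1 τ‖ = Real.exp (-(2 * π) * τ.im) := fun τ => by
    have := norm_qPow 1 τ
    push_cast at this
    rw [this]
    ring_nf
  simp only [h]
  refine Real.tendsto_exp_atBot.comp ?_
  exact (tendsto_comap (f := UpperHalfPlane.im)).const_mul_atTop_of_neg
    (by linarith [Real.pi_pos])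

/-- The matrix q^(1-Λ) Ξ tends to the identity at the cusp, so its determinant tends to 1. -/
theorem IsCanonicalBasis.exists_det_ne_zero {hΛ : IsExponent ρ Λ} (hB : IsCanonicalBasis hΛ B) :
    ∃ τ, (fundamentalMatrix B τ).det ≠ 0 := by
  have h1 : Tendsto (fun τ => Matrix.diagonal (fun ξ => qPow (1 - (Λ ξ : ℂ)) τ) *
      fundamentalMatrix B τ) atImInfty (𝓝 1) := by
    refine tendsto_pi_nhds.mpr fun ξ => tendsto_pi_nhds.mpr fun η => ?_
    have h := ((hB.isBigO_fundamentalMatrix ξ η).trans_tendsto tendsto_qPow_one).add_const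
      (if ξ = η then (1 : ℂ) else 0)
    simp only [sub_add_cancel, zero_add] at h
    simpa [Matrix.diagonal_mul, Matrix.one_apply] using h
  have h2 := ((continuous_id.matrix_det).tendsto (1 : Matrix (Fin d) (Fin d) ℂ)).comp h1
  rw [id, Matrix.det_one] at h2
  obtain ⟨τ, hτ⟩ := (h2.eventually_ne one_ne_zero).exists
  refine ⟨τ, fun h => hτ ?_⟩
  rw [Function.comp_apply, id, Matrix.det_mul, h, mul_zero]

theorem fundamentalMatrix_smul (γ : SL(2, ℤ)) (τ : ℍ) :
    fundamentalMatrix B (γ • τ) =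
      (ρ γ : Matrix (Fin d) (Fin d) ℂ) * fundamentalMatrix B τ := by
  ext ξ η
  exact congrFun ((B η 1).2.2.1 γ τ) ξ

/-! ### The compatibility equation -/

/-- Comparison of principal parts, which have order at most 2. Both sides have (Λ_η - 1) e_η at q⁻².
At q⁻¹ the left side has -240 (Λ_η - 1) e_η plus Λ_ζ 𝒳_ζη in each component ζ, while J contributes
(Λ_η - 1) 𝒳_ζη. The difference 𝒳 + Λ𝒳 - 𝒳Λ is made up by the vectors with a simple pole. -/
theorem IsCanonicalBasis.modDeriv_eq {hΛ : IsExponent ρ Λ} (hB : IsCanonicalBasis hΛ B)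
    (hb : Function.Injective (principalPart ρ Λ hΛ)) (η : Fin d) :
    (⟨_, modDeriv_mem hΛ (B η 1).2⟩ : modFun ρ) =
      ((Λ η : ℂ) - 1) • (⟨_, hauptmodul_smul_mem hΛ (B η 1).2⟩ : modFun ρ)
      - (240 * ((Λ η : ℂ) - 1)) • B η 1
      + ∑ ζ, (characteristicMatrix Λ B ζ η + ((Λ ζ : ℂ) * characteristicMatrix Λ B ζ η
        - characteristicMatrix Λ B ζ η * Λ η)) • B ζ 1 := by
  refine eq_of_vecCoeff_neg_eq hΛ hb fun k => ?_
  have hk := k.pos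
  have hlt : ∀ n < (-1 : ℤ), vecCoeff Λ (B η 1) n = 0 := fun n hn =>
    hB.vecCoeff_lt η 1 (by simpa using hn)
  have h1 : vecCoeff Λ (B η 1) (-1) = Pi.single η 1 := by
    rw [hB.vecCoeff_neg η 1 (by lia), if_pos (by simp)]
  have hone : ∀ ζ, vecCoeff Λ (B ζ 1) (-(k : ℤ)) = if k = 1 then Pi.single ζ 1 else 0 :=
    fun ζ => by
    rw [hB.vecCoeff_neg ζ 1 (show -(k : ℤ) < 0 by lia)]
    refine if_congr ?_ rfl rfl
    rw [← PNat.coe_inj, PNat.one_coe]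
    lia
  obtain ⟨-, -, hE1, hE0⟩ := hasLead_calE.coeff_eq
  rw [neg_add_cancel] at hE0
  rw [← vecCoeffL_apply hΛ, ← vecCoeffL_apply hΛ, map_add, map_sub, map_sum]
  simp only [map_smul, vecCoeffL_apply, hone, hB.vecCoeff_hauptmodul_smul]
  funext ξ
  rw [vecCoeff_eq (hasQSeries_twist_modDeriv hΛ (B η 1).2 hlt ξ)]
  have hsum : ∀ c : Fin d → ℂ, (∑ ζ, c ζ • (Pi.single ζ 1 : Fin d → ℂ)) ξ = c ξ := fun c => by
    simp [Finset.sum_apply, Pi.single_apply]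
  obtain rfl | rfl | hk3 : k = 1 ∨ k = 2 ∨ 3 ≤ (k : ℕ) := by
    by_cases h : 3 ≤ (k : ℕ)
    · exact Or.inr (Or.inr h)
    · rw [← PNat.coe_inj, ← PNat.coe_inj]
      have : ((2 : ℕ+) : ℕ) = 2 := rfl
      rw [this, PNat.one_coe]
      lia
  · have e : Finset.Icc (-1 : ℤ) (-((1 : ℕ+) : ℤ) - -1) = {-1, 0} := by decide
    rw [e, Finset.sum_pair (by decide)]
    simp only [if_true, Pi.add_apply, Pi.sub_apply, Pi.smul_apply, hsum, PNat.one_coe,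
      Nat.cast_one, sub_self, jCoeff_zero, hE1, hE0, characteristicMatrix, Matrix.of_apply,
      smul_eq_mul, sub_zero, h1]
    by_cases h : ξ = η
    · subst h
      simp
      ring
    · simp [h]
      ring
  · have e : Finset.Icc (-1 : ℤ) (-((2 : ℕ+) : ℤ) - -1) = {-1} := by decide
    have e2 : (-((2 : ℕ+) : ℤ) - -1) = -1 := by decide
    have e3 : (((1 : ℕ+) : ℤ) - ((2 : ℕ+) : ℤ)) = -1 := by decide
    have e4 : ¬ (2 : ℕ+) = 1 := by decide
    rw [e, Finset.sum_singleton, e2, e3, h1, hE1, jCoeff_neg_one]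
    simp only [e4, if_false]
    by_cases h : ξ = η
    · subst h
      simp
      ring
    · simp [h]
  · have e4 : ¬ k = 1 := by
      rintro rfl
      simp at hk3
    rw [Finset.Icc_eq_empty (by lia), Finset.sum_empty, jCoeff_lt (by push_cast; lia)]
    simp [e4]

theorem IsCanonicalBasis.calE_smul_qDeriv {hΛ : IsExponent ρ Λ} (hB : IsCanonicalBasis hΛ B)
    (hb : Function.Injective (principalPart ρ Λ hΛ)) (τ : ℍ) :
    calE τ • qDeriv (fundamentalMatrix B) τ =
      fundamentalMatrix B τ * compatNumerator Λ (characteristicMatrix Λ B) τ := by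
  ext ξ η
  have h := congrFun (congrFun (congrArg (Subtype.val : modFun ρ → ℍ → Fin d → ℂ)
    (hB.modDeriv_eq hb η)) τ) ξ
  change modDeriv (B η 1) τ ξ = _ at h
  rw [Matrix.smul_apply, qDeriv, Matrix.of_apply, smul_eq_mul]
  refine Eq.trans h ?_
  have hN : ∀ ζ, compatNumerator Λ (characteristicMatrix Λ B) τ ζ η =
      (if ζ = η then (hauptmodul τ - 240) * ((Λ η : ℂ) - 1) else 0) +
      (characteristicMatrix Λ B ζ η + ((Λ ζ : ℂ) * characteristicMatrix Λ B ζ η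
        - characteristicMatrix Λ B ζ η * Λ η)) := fun ζ => by
    rw [compatNumerator, Matrix.add_apply, Matrix.add_apply, Matrix.sub_apply,
      Matrix.diagonal_mul, Matrix.mul_diagonal, Matrix.smul_apply, Matrix.sub_apply, add_assoc]
    by_cases h : ζ = η
    · subst h; simp
    · simp [h]
  rw [Matrix.mul_apply]
  simp only [hN]
  push_cast
  simp only [Pi.add_apply, Pi.sub_apply, Pi.smul_apply, Pi.smul_apply', Finset.sum_apply,
    smul_eq_mul, fundamentalMatrix, Matrix.of_apply, mul_add, Finset.sum_add_distrib, mul_ite,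
    mul_zero, Finset.sum_ite_eq', Finset.mem_univ, if_true, add_mul]
  simp only [← Finset.sum_add_distrib]
  congr 1
  · ring
  · refine Finset.sum_congr rfl fun ζ _ => ?_
    ring

theorem IsCanonicalBasis.qDeriv_eq {hΛ : IsExponent ρ Λ} (hB : IsCanonicalBasis hΛ B)
    (hb : Function.Injective (principalPart ρ Λ hΛ)) {τ : ℍ} (hτ : calE τ ≠ 0) :
    qDeriv (fundamentalMatrix B) τ =
      fundamentalMatrix B τ * compatD Λ (characteristicMatrix Λ B) τ := by
  rw [compatD, Matrix.mul_smul, ← hB.calE_smul_qDeriv hb, inv_smul_smul₀ hτ]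

end

section

/-! ### Polynomial growth of the representation -/

variable {d : ℕ} {ρ : SL(2, ℤ) →* GL (Fin d) ℂ} {Λ : Fin d → ℚ}

theorem mulVec_mul (ρ : SL(2, ℤ) →* GL (Fin d) ℂ) (γ δ : SL(2, ℤ)) (v : Fin d → ℂ) :
    (ρ (γ * δ) : Matrix (Fin d) (Fin d) ℂ) *ᵥ v =
      (ρ γ : Matrix (Fin d) (Fin d) ℂ) *ᵥ ((ρ δ : Matrix (Fin d) (Fin d) ℂ) *ᵥ v) := by
  rw [map_mul, Units.val_mul, Matrix.mulVec_mulVec]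

theorem mulVec_one (ρ : SL(2, ℤ) →* GL (Fin d) ℂ) (v : Fin d → ℂ) :
    (ρ 1 : Matrix (Fin d) (Fin d) ℂ) *ᵥ v = v := by
  rw [map_one, Units.val_one, Matrix.one_mulVec]

theorem map_neg_eq (hneg : ρ (-1) = 1) (γ : SL(2, ℤ)) : ρ (-γ) = ρ γ := by
  rw [← neg_one_mul, map_mul, hneg, one_mul]

/-- The elements that act by isometries of the supremum norm. -/
def isometrySubgroup (ρ : SL(2, ℤ) →* GL (Fin d) ℂ) : Subgroup SL(2, ℤ) where
  carrier := {γ | ∀ v : Fin d → ℂ, ‖(ρ γ : Matrix (Fin d) (Fin d) ℂ) *ᵥ v‖ = ‖v‖}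
  mul_mem' {γ δ} hγ hδ v := by rw [mulVec_mul, hγ, hδ]
  one_mem' v := by rw [mulVec_one]
  inv_mem' {γ} hγ v := by rw [← hγ, ← mulVec_mul, mul_inv_cancel, mulVec_one]

/-- Λ is real, so the diagonal entries of ρ(T) have absolute value 1. Powers of T therefore cost
nothing in the growth estimate. -/
theorem IsExponent.T_mem_isometrySubgroup (hΛ : IsExponent ρ Λ) :
    ModularGroup.T ∈ isometrySubgroup ρ := by
  intro v
  rw [hΛ, Pi.norm_def, Pi.norm_def]
  congr 2
  funext ξ
  rw [Matrix.mulVec_diagonal, nnnorm_mul]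
  have : ‖cexp (2 * π * Complex.I * (Λ ξ : ℂ))‖₊ = 1 := by
    ext
    rw [coe_nnnorm, Complex.norm_exp]
    simp
  rw [this, one_mul]

theorem eq_T_zpow_of_lower_left_eq_zero {γ : SL(2, ℤ)} (h : γ 1 0 = 0) :
    ∃ n : ℤ, γ = ModularGroup.T ^ n ∨ γ = -ModularGroup.T ^ n := by
  have hdet := γ.det_coe
  rw [Matrix.det_fin_two, h, mul_zero, sub_zero] at hdet
  rcases Int.eq_one_or_neg_one_of_mul_eq_one hdet with h0 | h0
  · rw [h0, one_mul] at hdet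
    refine ⟨γ 0 1, Or.inl ?_⟩
    ext i j
    rw [ModularGroup.coe_T_zpow]
    fin_cases i <;> fin_cases j <;> simp [h, h0, hdet]
  · rw [h0] at hdet
    refine ⟨-γ 0 1, Or.inr ?_⟩
    have h1 : γ 1 1 = -1 := by lia
    ext i j
    rw [Matrix.SpecialLinearGroup.coe_neg, ModularGroup.coe_T_zpow]
    fin_cases i <;> fin_cases j <;> simp [h, h0, h1]

theorem IsExponent.mem_isometrySubgroup (hΛ : IsExponent ρ Λ) (hneg : ρ (-1) = 1)
    {γ : SL(2, ℤ)} (h : γ 1 0 = 0) : γ ∈ isometrySubgroup ρ := by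
  obtain ⟨n, rfl | rfl⟩ := eq_T_zpow_of_lower_left_eq_zero h
  · exact Subgroup.zpow_mem _ hΛ.T_mem_isometrySubgroup n
  · intro v
    rw [map_neg_eq hneg]
    exact Subgroup.zpow_mem _ hΛ.T_mem_isometrySubgroup n v

theorem exists_norm_mulVec_le (A : Matrix (Fin d) (Fin d) ℂ) :
    ∃ M : ℝ, ∀ v : Fin d → ℂ, ‖A *ᵥ v‖ ≤ M * ‖v‖ :=
  ⟨_, fun v => (LinearMap.toContinuousLinearMap A.mulVecLin).le_opNorm v⟩

theorem exists_two_mul_abs_add_mul_le (a : ℤ) {c : ℤ} (hc : c ≠ 0) :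
    ∃ n : ℤ, 2 * |a + n * c| ≤ |c| := by
  obtain ⟨b, hb⟩ : ∃ b, b = |c| := ⟨_, rfl⟩
  have hb0 : 0 < b := hb ▸ abs_pos.mpr hc
  have h1 := Int.emod_add_mul_ediv a b
  have h2 := Int.emod_nonneg a hb0.ne'
  have h3 := Int.emod_lt_of_pos a hb0
  have hr : ∃ n : ℤ, 2 * |a + n * b| ≤ b := by
    rcases le_or_gt (2 * (a % b)) b with h | h
    · refine ⟨-(a / b), ?_⟩
      rw [show a + -(a / b) * b = a % b by linarith, abs_of_nonneg h2]
      exact h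
    · refine ⟨-(a / b) - 1, ?_⟩
      rw [show a + (-(a / b) - 1) * b = a % b - b by linarith, abs_of_nonpos (by lia)]
      lia
  rw [← hb]
  obtain ⟨n, hn⟩ := hr
  rcases abs_choice c with h | h
  · exact ⟨n, by rw [hb.trans h] at hn ⊢; exact hn⟩
  · refine ⟨-n, ?_⟩
    rwa [show a + -n * c = a + n * -c by ring, ← h, ← hb]

/-- The operator norm of `ρ γ` grows at most polynomially in the lower left entry of `γ`. -/
theorem exists_norm_mulVec_le_pow (hneg : ρ (-1) = 1) (hΛ : IsExponent ρ Λ) :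
    ∃ (M : ℝ) (K : ℕ), 1 ≤ M ∧ ∀ (γ : SL(2, ℤ)) (v : Fin d → ℂ),
      ‖(ρ γ : Matrix (Fin d) (Fin d) ℂ) *ᵥ v‖ ≤ M * |((γ 1 0 : ℤ) : ℝ)| ^ K * ‖v‖ ∨
        γ 1 0 = 0 ∧ ‖(ρ γ : Matrix (Fin d) (Fin d) ℂ) *ᵥ v‖ = ‖v‖ := by
  obtain ⟨M₀, hM₀⟩ := exists_norm_mulVec_le (ρ ModularGroup.S⁻¹ : Matrix (Fin d) (Fin d) ℂ)
  set M := max M₀ 1 with hM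
  have hM1 : 1 ≤ M := le_max_right _ _
  have hMS : ∀ v : Fin d → ℂ,
      ‖(ρ ModularGroup.S⁻¹ : Matrix (Fin d) (Fin d) ℂ) *ᵥ v‖ ≤ M * ‖v‖ := fun v =>
    (hM₀ v).trans (mul_le_mul_of_nonneg_right (le_max_left _ _) (norm_nonneg _))
  -- One Euclidean step multiplies the norm by at most M ≤ 2^K and at least halves the lower left
  -- entry, so the K-th power of that entry absorbs the loss. The case of a zero entry is kept
  -- apart, because 0^K would be no bound.
  obtain ⟨K, hK⟩ := pow_unbounded_of_one_lt M (one_lt_two (α := ℝ))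
  refine ⟨M, K, hM1, fun γ => ?_⟩
  induction hn : (γ 1 0).natAbs using Nat.strong_induction_on generalizing γ with
  | _ N ih =>
    intro v
    by_cases hc : γ 1 0 = 0
    · exact Or.inr ⟨hc, hΛ.mem_isometrySubgroup hneg hc v⟩
    left
    obtain ⟨n, hn2⟩ := exists_two_mul_abs_add_mul_le (γ 1 1) hc
    set γ' := γ * ModularGroup.T ^ n * ModularGroup.S with hγ'
    have hlow : γ' 1 0 = γ 1 1 + n * γ 1 0 := by
      rw [hγ', Matrix.SpecialLinearGroup.coe_mul, Matrix.SpecialLinearGroup.coe_mul,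
        ModularGroup.coe_T_zpow, ModularGroup.S]
      simp [Matrix.mul_apply, Fin.sum_univ_two]
      ring
    have hγ : γ = γ' * (ModularGroup.S⁻¹ * ModularGroup.T ^ (-n)) := by
      rw [hγ', _root_.zpow_neg]
      group
    have hc1 : (1 : ℝ) ≤ |((γ 1 0 : ℤ) : ℝ)| := by
      have := Int.one_le_abs hc
      exact_mod_cast this
    have hc2 : 2 * |((γ' 1 0 : ℤ) : ℝ)| ≤ |((γ 1 0 : ℤ) : ℝ)| := by
      rw [hlow]
      exact_mod_cast hn2
    set w := (ρ (ModularGroup.S⁻¹ * ModularGroup.T ^ (-n)) : Matrix (Fin d) (Fin d) ℂ) *ᵥ v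
      with hw
    have hwv : ‖w‖ ≤ M * ‖v‖ := by
      rw [hw, mulVec_mul]
      refine (hMS _).trans_eq ?_
      rw [Subgroup.zpow_mem _ hΛ.T_mem_isometrySubgroup (-n) v]
    have hlt : (γ' 1 0).natAbs < N := by
      rw [hlow, ← hn]
      have h1 := abs_pos.mpr hc
      have h2 := abs_nonneg (γ 1 1 + n * γ 1 0)
      zify
      linarith
    have hv : (ρ γ : Matrix (Fin d) (Fin d) ℂ) *ᵥ v =
        (ρ γ' : Matrix (Fin d) (Fin d) ℂ) *ᵥ w := by
      rw [hw, ← mulVec_mul, ← hγ]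
    rw [hv]
    rcases ih _ hlt γ' rfl w with h | ⟨-, h⟩
    · refine h.trans ?_
      calc M * |((γ' 1 0 : ℤ) : ℝ)| ^ K * ‖w‖
          ≤ M * |((γ' 1 0 : ℤ) : ℝ)| ^ K * (2 ^ K * ‖v‖) := by
            gcongr
            exact hwv.trans (mul_le_mul_of_nonneg_right hK.le (norm_nonneg _))
        _ = M * (2 * |((γ' 1 0 : ℤ) : ℝ)|) ^ K * ‖v‖ := by rw [mul_pow]; ring
        _ ≤ _ := by gcongr
    · rw [h]
      refine hwv.trans ?_
      rw [mul_assoc]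
      refine mul_le_mul_of_nonneg_left ?_ (by linarith)
      exact le_mul_of_one_le_left (norm_nonneg _) (one_le_pow₀ hc1)

end

section

/-! ### Poincaré series -/

variable {d : ℕ} {ρ : SL(2, ℤ) →* GL (Fin d) ℂ} {Λ : Fin d → ℚ}

theorem denom_mul (γ δ : SL(2, ℤ)) (τ : ℍ) :
    denom ((γ * δ : SL(2, ℤ)) : GL (Fin 2) ℝ) τ =
      denom (γ : GL (Fin 2) ℝ) (δ • τ : ℍ) * denom (δ : GL (Fin 2) ℝ) τ := by
  rw [map_mul, map_mul, denom_cocycle _ _ τ.im_ne_zero, ModularGroup.sl_moeb,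
    UpperHalfPlane.coe_smul_of_det_pos (by simp)]

/-- The terms of the Poincaré series of weight `k` attached to `q ^ r e`. -/
def poincareTerm (ρ : SL(2, ℤ) →* GL (Fin d) ℂ) (k : ℕ) (r : ℂ) (e : Fin d → ℂ) (γ : SL(2, ℤ))
    (τ : ℍ) : Fin d → ℂ :=
  (denom γ τ ^ (-(k : ℤ)) * qPow r (γ • τ)) • ((ρ γ⁻¹ : Matrix (Fin d) (Fin d) ℂ) *ᵥ e)

variable {k : ℕ} {r : ℂ} {e : Fin d → ℂ}

theorem poincareTerm_one (τ : ℍ) : poincareTerm ρ k r e 1 τ = qPow r τ • e := by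
  rw [poincareTerm, inv_one, mulVec_one, one_smul, ModularGroup.denom_apply]
  simp

theorem poincareTerm_neg (hneg : ρ (-1) = 1) (hk : Even k) (γ : SL(2, ℤ)) (τ : ℍ) :
    poincareTerm ρ k r e (-γ) τ = poincareTerm ρ k r e γ τ := by
  rw [poincareTerm, poincareTerm, inv_neg, map_neg_eq hneg, ModularGroup.SL_neg_smul,
    ModularGroup.denom_apply, ModularGroup.denom_apply]
  congr 2
  have h1 : (((-γ : SL(2, ℤ)) 1 0 : ℤ) : ℂ) * τ + ((-γ : SL(2, ℤ)) 1 1 : ℤ) =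
      -((γ 1 0 : ℤ) * τ + (γ 1 1 : ℤ)) := by
    rw [Matrix.SpecialLinearGroup.coe_neg]
    simp
    ring
  rw [h1, Even.neg_zpow (by simpa using hk)]

theorem poincareTerm_T_mul
    (he : (ρ ModularGroup.T : Matrix (Fin d) (Fin d) ℂ) *ᵥ e = cexp (2 * π * Complex.I * r) • e)
    (γ : SL(2, ℤ)) (τ : ℍ) :
    poincareTerm ρ k r e (ModularGroup.T * γ) τ = poincareTerm ρ k r e γ τ := by
  have h1 : (ρ ModularGroup.T⁻¹ : Matrix (Fin d) (Fin d) ℂ) *ᵥ e =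
      (cexp (2 * π * Complex.I * r))⁻¹ • e := by
    have := congrArg (fun v => (ρ ModularGroup.T⁻¹ : Matrix (Fin d) (Fin d) ℂ) *ᵥ v) he
    simp only [← mulVec_mul, inv_mul_cancel, mulVec_one, Matrix.mulVec_smul] at this
    rw [eq_inv_smul_iff₀ (Complex.exp_ne_zero _)]
    exact this.symm
  have h2 : denom ((ModularGroup.T * γ : SL(2, ℤ)) : GL (Fin 2) ℝ) τ = denom γ τ := by
    rw [denom_mul, ModularGroup.denom_apply ModularGroup.T]
    simp [ModularGroup.T]
  have h3 : (ModularGroup.T * γ) • τ = (1 : ℝ) +ᵥ (γ • τ) := by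
    rw [mul_smul, UpperHalfPlane.modular_T_smul]
  have h4 := Complex.exp_ne_zero (2 * π * Complex.I * r)
  rw [poincareTerm, poincareTerm, h2, h3, _root_.mul_inv_rev, mulVec_mul, h1, Matrix.mulVec_smul,
    qPow_vadd_one, smul_smul]
  congr 1
  rw [mul_comm (cexp _), ← mul_assoc, mul_inv_cancel_right₀ h4]

theorem poincareTerm_T_zpow_mul
    (he : (ρ ModularGroup.T : Matrix (Fin d) (Fin d) ℂ) *ᵥ e = cexp (2 * π * Complex.I * r) • e)
    (n : ℤ) (γ : SL(2, ℤ)) (τ : ℍ) :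
    poincareTerm ρ k r e (ModularGroup.T ^ n * γ) τ = poincareTerm ρ k r e γ τ := by
  induction n using Int.induction_on generalizing γ with
  | zero => simp
  | succ n ih => rw [_root_.zpow_add_one, mul_assoc, ih, poincareTerm_T_mul he]
  | pred n ih =>
    rw [_root_.zpow_sub_one, mul_assoc, ih, ← poincareTerm_T_mul he, mul_inv_cancel_left]

theorem poincareTerm_eq_of_lower_left_eq_zero (hneg : ρ (-1) = 1) (hk : Even k)
    (he : (ρ ModularGroup.T : Matrix (Fin d) (Fin d) ℂ) *ᵥ e = cexp (2 * π * Complex.I * r) • e)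
    {γ : SL(2, ℤ)} (h : γ 1 0 = 0) (δ : SL(2, ℤ)) (τ : ℍ) :
    poincareTerm ρ k r e (γ * δ) τ = poincareTerm ρ k r e δ τ := by
  obtain ⟨n, rfl | rfl⟩ := eq_T_zpow_of_lower_left_eq_zero h
  · exact poincareTerm_T_zpow_mul he n δ τ
  · rw [neg_mul, poincareTerm_neg hneg hk, poincareTerm_T_zpow_mul he]

/-- Matrices with equal bottom rows differ on the left by ±T^n. The sign is harmless in even weight,
and T^n is absorbed by the eigenvector condition on e. So the series may be indexed by coprime pairs
with arbitrary lifts. -/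
theorem poincareTerm_congr (hneg : ρ (-1) = 1) (hk : Even k)
    (he : (ρ ModularGroup.T : Matrix (Fin d) (Fin d) ℂ) *ᵥ e = cexp (2 * π * Complex.I * r) • e)
    {γ δ : SL(2, ℤ)} (h0 : γ 1 0 = δ 1 0) (h1 : γ 1 1 = δ 1 1) (τ : ℍ) :
    poincareTerm ρ k r e γ τ = poincareTerm ρ k r e δ τ := by
  have h : (γ * δ⁻¹) 1 0 = 0 := by
    rw [Matrix.SpecialLinearGroup.coe_mul, Matrix.SpecialLinearGroup.coe_inv,
      Matrix.adjugate_fin_two, Matrix.mul_apply, Fin.sum_univ_two]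
    simp [h0, h1]
    ring
  rw [← poincareTerm_eq_of_lower_left_eq_zero hneg hk he h δ τ, inv_mul_cancel_right]

theorem poincareTerm_smul (γ δ : SL(2, ℤ)) (τ : ℍ) :
    poincareTerm ρ k r e γ (δ • τ) =
      denom δ τ ^ k • ((ρ δ : Matrix (Fin d) (Fin d) ℂ) *ᵥ poincareTerm ρ k r e (γ * δ) τ) := by
  have h := denom_ne_zero (δ : GL (Fin 2) ℝ) τ
  have h3 : (γ * δ) • τ = γ • δ • τ := mul_smul γ δ τ
  rw [poincareTerm, poincareTerm, Matrix.mulVec_smul, ← mulVec_mul, _root_.mul_inv_rev,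
    mul_inv_cancel_left, smul_smul, denom_mul, h3, mul_zpow, _root_.zpow_neg (denom δ τ),
    zpow_natCast, mul_assoc, mul_left_comm _ _ (qPow _ _), mul_smul (_)⁻¹,
    smul_inv_smul₀ (pow_ne_zero k h)]

/-- Bottom rows of elements of `SL(2, ℤ)`. -/
abbrev CoprimePair : Type := {v : Fin 2 → ℤ // IsCoprime (v 0) (v 1)}

/-- An element of `SL(2, ℤ)` with prescribed bottom row. -/
def CoprimePair.lift (v : CoprimePair) : SL(2, ℤ) := (v.2.exists_SL2_row 1).choose

theorem CoprimePair.lift_zero (v : CoprimePair) : v.lift 1 0 = v.1 0 :=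
  (v.2.exists_SL2_row 1).choose_spec.1

theorem CoprimePair.lift_one (v : CoprimePair) : v.lift 1 1 = v.1 1 :=
  (v.2.exists_SL2_row 1).choose_spec.2

/-- Right multiplication on bottom rows. -/
def CoprimePair.mulRight (δ : SL(2, ℤ)) : CoprimePair ≃ CoprimePair where
  toFun v := ⟨v.1 ᵥ* δ, v.2.vecMulSL δ⟩
  invFun v := ⟨v.1 ᵥ* (δ⁻¹ : SL(2, ℤ)), v.2.vecMulSL δ⁻¹⟩
  left_inv v := by
    ext1
    change v.1 ᵥ* δ.1 ᵥ* (δ⁻¹ : SL(2, ℤ)).1 = v.1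
    rw [Matrix.vecMul_vecMul, ← Matrix.SpecialLinearGroup.coe_mul, mul_inv_cancel,
      Matrix.SpecialLinearGroup.coe_one, Matrix.vecMul_one]
  right_inv v := by
    ext1
    change v.1 ᵥ* (δ⁻¹ : SL(2, ℤ)).1 ᵥ* δ.1 = v.1
    rw [Matrix.vecMul_vecMul, ← Matrix.SpecialLinearGroup.coe_mul, inv_mul_cancel,
      Matrix.SpecialLinearGroup.coe_one, Matrix.vecMul_one]

theorem CoprimePair.lift_mulRight (δ : SL(2, ℤ)) (v : CoprimePair) (j : Fin 2) :
    (CoprimePair.mulRight δ v).lift 1 j = (v.lift * δ) 1 j := by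
  have h : (CoprimePair.mulRight δ v).lift 1 j = (v.1 ᵥ* δ) j := by
    fin_cases j
    · exact CoprimePair.lift_zero _
    · exact CoprimePair.lift_one _
  rw [h, Matrix.SpecialLinearGroup.coe_mul, Matrix.mul_apply, Matrix.vecMul, dotProduct,
    Fin.sum_univ_two, Fin.sum_univ_two, v.lift_zero, v.lift_one]

/-- The Poincaré series of weight `k` attached to `q ^ r e`. -/
def poincare (ρ : SL(2, ℤ) →* GL (Fin d) ℂ) (k : ℕ) (r : ℂ) (e : Fin d → ℂ) (τ : ℍ) :
    Fin d → ℂ :=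
  ∑' v : CoprimePair, poincareTerm ρ k r e v.lift τ

/-- Right multiplication by δ permutes the bottom rows. The chosen lifts are not equivariant, but
their bottom rows are, and the terms depend on nothing else. -/
theorem poincare_smul (hneg : ρ (-1) = 1) (hk : Even k)
    (he : (ρ ModularGroup.T : Matrix (Fin d) (Fin d) ℂ) *ᵥ e = cexp (2 * π * Complex.I * r) • e)
    (hsum : ∀ τ, Summable fun v : CoprimePair => poincareTerm ρ k r e v.lift τ)
    (δ : SL(2, ℤ)) (τ : ℍ) :
    poincare ρ k r e (δ • τ) =
      denom δ τ ^ k • ((ρ δ : Matrix (Fin d) (Fin d) ℂ) *ᵥ poincare ρ k r e τ) := by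
  have h1 : ∀ v : CoprimePair, poincareTerm ρ k r e v.lift (δ • τ) =
      (denom δ τ ^ k • LinearMap.toContinuousLinearMap
        (ρ δ : Matrix (Fin d) (Fin d) ℂ).mulVecLin)
        (poincareTerm ρ k r e (CoprimePair.mulRight δ v).lift τ) := fun v => by
    rw [poincareTerm_smul, poincareTerm_congr hneg hk he (CoprimePair.lift_mulRight δ v 0)
      (CoprimePair.lift_mulRight δ v 1)]
    rfl
  rw [poincare]
  simp only [h1]
  have h2 := (CoprimePair.mulRight δ).hasSum_iff.mpr (hsum τ).hasSum
  exact (h2.mapL (denom δ τ ^ k • LinearMap.toContinuousLinearMap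
    (ρ δ : Matrix (Fin d) (Fin d) ℂ).mulVecLin)).tsum_eq

/-- The part of the Poincaré series coming from non-zero lower left entries. -/
def poincareTail (ρ : SL(2, ℤ) →* GL (Fin d) ℂ) (k : ℕ) (r : ℂ) (e : Fin d → ℂ) (v : CoprimePair)
    (τ : ℍ) : Fin d → ℂ :=
  if v.1 0 = 0 then 0 else poincareTerm ρ k r e v.lift τ

theorem hasSum_poincareTerm_sub_tail (hneg : ρ (-1) = 1) (hk : Even k)
    (he : (ρ ModularGroup.T : Matrix (Fin d) (Fin d) ℂ) *ᵥ e = cexp (2 * π * Complex.I * r) • e)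
    (τ : ℍ) :
    HasSum (fun v : CoprimePair => poincareTerm ρ k r e v.lift τ - poincareTail ρ k r e v τ)
      ((2 : ℂ) • qPow r τ • e) := by
  -- The only coprime pairs starting with 0 are (0, ±1). Each contributes q^r e, whence the factor
  -- 2.
  set v₁ : CoprimePair := ⟨![0, 1], by simp [isCoprime_zero_left]⟩ with hv₁
  set v₂ : CoprimePair := ⟨![0, -1], by simp [isCoprime_zero_left]⟩ with hv₂
  have hne : v₁ ≠ v₂ := fun h => by
    have := congrFun (congrArg Subtype.val h) 1
    simp [hv₁, hv₂] at this
  have hval : ∀ v : CoprimePair, v.1 0 = 0 →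
      poincareTerm ρ k r e v.lift τ - poincareTail ρ k r e v τ = qPow r τ • e := fun v hv => by
    rw [poincareTail, if_pos hv, sub_zero, ← mul_one v.lift,
      poincareTerm_eq_of_lower_left_eq_zero hneg hk he (v.lift_zero.trans hv), poincareTerm_one]
  have hzero : ∀ v ∉ ({v₁, v₂} : Finset CoprimePair),
      poincareTerm ρ k r e v.lift τ - poincareTail ρ k r e v τ = 0 := fun v hv => by
    have hv0 : v.1 0 ≠ 0 := by
      intro h0
      apply hv
      have h1 := v.2
      rw [h0, isCoprime_zero_left, Int.isUnit_iff] at h1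
      rw [Finset.mem_insert, Finset.mem_singleton]
      rcases h1 with h1 | h1
      · left
        ext j
        fin_cases j
        · exact h0
        · exact h1
      · right
        ext j
        fin_cases j
        · exact h0
        · exact h1
    rw [poincareTail, if_neg hv0, sub_self]
  have h : HasSum (fun v : CoprimePair => poincareTerm ρ k r e v.lift τ - poincareTail ρ k r e v τ)
    _ := hasSum_sum_of_ne_finset_zero hzero
  rwa [Finset.sum_pair hne, hval v₁ rfl, hval v₂ rfl, ← two_smul ℂ] at h

theorem poincare_eq (hneg : ρ (-1) = 1) (hk : Even k)
    (he : (ρ ModularGroup.T : Matrix (Fin d) (Fin d) ℂ) *ᵥ e = cexp (2 * π * Complex.I * r) • e)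
    {τ : ℍ} (hsum : Summable fun v => poincareTail ρ k r e v τ) :
    (Summable fun v : CoprimePair => poincareTerm ρ k r e v.lift τ) ∧
      poincare ρ k r e τ = (2 : ℂ) • qPow r τ • e + ∑' v, poincareTail ρ k r e v τ := by
  have h := (hasSum_poincareTerm_sub_tail hneg hk he τ).add hsum.hasSum
  simp only [sub_add_cancel] at h
  exact ⟨h.summable, h.tsum_eq⟩

/-- Termwise bounds for the tail of the Poincaré series on vertical strips. -/
theorem exists_norm_poincareTail_le {M : ℝ} {K : ℕ} (hM : 1 ≤ M)
    (hgrowth : ∀ (γ : SL(2, ℤ)) (v : Fin d → ℂ),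
      ‖(ρ γ : Matrix (Fin d) (Fin d) ℂ) *ᵥ v‖ ≤ M * |((γ 1 0 : ℤ) : ℝ)| ^ K * ‖v‖ ∨
        γ 1 0 = 0 ∧ ‖(ρ γ : Matrix (Fin d) (Fin d) ℂ) *ᵥ v‖ = ‖v‖)
    {j : ℕ} (hj : 3 ≤ j) (s : ℝ) (hs : s ≤ 0) (e : Fin d → ℂ) (A : ℝ) {B : ℝ} (hB : 0 < B) :
    ∃ u : CoprimePair → ℝ, Summable u ∧ ∀ v, ∀ τ ∈ verticalStrip A B,
      ‖poincareTail ρ (K + j) s e v τ‖ ≤ u v := by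
  -- For c ≠ 0 the denominator satisfies |c| Im τ ≤ ‖D‖. Hence Im γτ ≤ 1/B bounds the power of q,
  -- and |c| ≤ ‖D‖/B bounds ρ. K of the K + j powers of ‖D‖ pay for the growth of ρ; the other j ≥ 3
  -- give convergence as for Eisenstein series.
  set C := Real.exp (2 * π * (-s) / B) * (M * (B⁻¹) ^ K * ‖e‖) with hC
  have hC0 : 0 ≤ C := by positivity
  have hj' : (2 : ℝ) < j := by exact_mod_cast hj
  refine ⟨fun v => C * (EisensteinSeries.r ⟨⟨A, B⟩, hB⟩ ^ (-(j : ℝ)) * ‖v.1‖ ^ (-(j : ℝ))),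
    (((EisensteinSeries.summable_one_div_norm_rpow hj').subtype _).mul_left _).mul_left _,
    fun v τ hτ => ?_⟩
  have hu0 : 0 ≤ C * (EisensteinSeries.r ⟨⟨A, B⟩, hB⟩ ^ (-(j : ℝ)) * ‖v.1‖ ^ (-(j : ℝ))) := by
    have := EisensteinSeries.r_pos ⟨⟨A, B⟩, hB⟩
    positivity
  rw [poincareTail]
  split_ifs with hv
  · simpa using hu0
  have hBτ : B ≤ τ.im := hτ.2
  set D := denom v.lift τ with hD
  have hD_eq : D = (v.1 0 : ℂ) * τ + v.1 1 := by
    rw [hD, ModularGroup.denom_apply, v.lift_zero, v.lift_one]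
  have hD0 : 0 < ‖D‖ := norm_pos_iff.mpr (denom_ne_zero _ _)
  have hcD : |(v.1 0 : ℝ)| * τ.im ≤ ‖D‖ := by
    have := Complex.abs_im_le_norm D
    rw [hD_eq] at this ⊢
    simpa [abs_mul, abs_of_pos τ.im_pos] using this
  have hc1 : (1 : ℝ) ≤ |(v.1 0 : ℝ)| := by
    have := Int.one_le_abs hv
    exact_mod_cast this
  have hDτ : τ.im ≤ ‖D‖ := (le_mul_of_one_le_left τ.im_pos.le hc1).trans hcD
  have him : (v.lift • τ).im ≤ 1 / B := by
    rw [ModularGroup.im_smul_eq_div_normSq, Complex.normSq_eq_norm_sq, ← hD,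
      div_le_div_iff₀ (by positivity) hB, one_mul, sq]
    exact mul_le_mul hDτ (hBτ.trans hDτ) hB.le hD0.le
  have hq : ‖qPow s (v.lift • τ)‖ ≤ Real.exp (2 * π * (-s) / B) := by
    rw [norm_qPow]
    gcongr
    have h1 := mul_le_mul_of_nonneg_left him
      (show 0 ≤ 2 * π * (-s) from mul_nonneg (by positivity) (by linarith))
    rw [mul_one_div] at h1
    linarith
  have hρ : ‖(ρ v.lift⁻¹ : Matrix (Fin d) (Fin d) ℂ) *ᵥ e‖ ≤
      M * (B⁻¹) ^ K * ‖e‖ * ‖D‖ ^ K := by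
    have hlow : ((v.lift⁻¹ : SL(2, ℤ)) 1 0) = -v.1 0 := by
      rw [Matrix.SpecialLinearGroup.coe_inv, Matrix.adjugate_fin_two]
      simp [v.lift_zero]
    have h1 := hgrowth v.lift⁻¹ e
    rw [hlow] at h1
    rcases h1 with h1 | ⟨h1, -⟩
    · refine h1.trans ?_
      have h2 : |((-v.1 0 : ℤ) : ℝ)| ≤ B⁻¹ * ‖D‖ := by
        push_cast
        rw [abs_neg, ← div_eq_inv_mul, le_div_iff₀ hB]
        exact (mul_le_mul_of_nonneg_left hBτ (abs_nonneg _)).trans hcD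
      calc M * |((-v.1 0 : ℤ) : ℝ)| ^ K * ‖e‖ ≤ M * (B⁻¹ * ‖D‖) ^ K * ‖e‖ := by gcongr
        _ = _ := by rw [mul_pow]; ring
    · exact absurd (neg_eq_zero.mp h1) hv
  have hDj : ‖D‖ ^ (-(j : ℝ)) ≤
      EisensteinSeries.r ⟨⟨A, B⟩, hB⟩ ^ (-(j : ℝ)) * ‖v.1‖ ^ (-(j : ℝ)) := by
    rw [hD_eq]
    exact EisensteinSeries.summand_bound_of_mem_verticalStrip (by linarith) v.1 hB hτ
  rw [poincareTerm, norm_smul, norm_mul, norm_zpow, ← hD]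
  calc ‖D‖ ^ (-((K + j : ℕ) : ℤ)) * ‖qPow s (v.lift • τ)‖ *
        ‖(ρ v.lift⁻¹ : Matrix (Fin d) (Fin d) ℂ) *ᵥ e‖
      ≤ ‖D‖ ^ (-((K + j : ℕ) : ℤ)) * Real.exp (2 * π * (-s) / B) *
        (M * (B⁻¹) ^ K * ‖e‖ * ‖D‖ ^ K) := by gcongr
    _ = C * ‖D‖ ^ (-(j : ℝ)) := by
        rw [_root_.zpow_neg, zpow_natCast, pow_add, Real.rpow_neg hD0.le, Real.rpow_natCast, hC]
        field_simp
    _ ≤ _ := mul_le_mul_of_nonneg_left hDj hC0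

theorem differentiableOn_poincareTail (v : CoprimePair) :
    DifferentiableOn ℂ (fun w => poincareTail ρ k r e v (ofComplex w)) {w | 0 < w.im} := by
  by_cases hv : v.1 0 = 0
  · simp only [poincareTail, if_pos hv]
    exact differentiableOn_const _
  · simp only [poincareTail, if_neg hv, poincareTerm]
    refine DifferentiableOn.smul_const ?_ _
    have h1 := (mdifferentiable_denom_zpow (v.lift : GL (Fin 2) ℝ) (-(k : ℤ))).mul
      ((mdifferentiable_qPow r).comp (mdifferentiable_smul (g := (v.lift : GL (Fin 2) ℝ))
        (by simp)))
    exact UpperHalfPlane.mdifferentiable_iff.mp h1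

theorem mdifferentiable_tsum_poincareTail
    (hbound : ∀ (A : ℝ) {B : ℝ}, 0 < B → ∃ u : CoprimePair → ℝ, Summable u ∧
      ∀ v, ∀ τ ∈ verticalStrip A B, ‖poincareTail ρ k r e v τ‖ ≤ u v) (ξ : Fin d) :
    MDifferentiable 𝓘(ℂ) 𝓘(ℂ) (fun τ => (∑' v, poincareTail ρ k r e v τ) ξ) := by
  rw [UpperHalfPlane.mdifferentiable_iff]
  intro w hw
  rw [Set.mem_ofPred_eq] at hw
  obtain ⟨u, hu, hle⟩ := hbound (|w.re| + 1) (half_pos hw)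
  set U : Set ℂ := {z | |z.re| < |w.re| + 1 ∧ w.im / 2 < z.im} with hU
  have hUo : IsOpen U :=
    (isOpen_lt (continuous_abs.comp Complex.continuous_re) continuous_const).and
      (isOpen_lt continuous_const Complex.continuous_im)
  have hsub : U ⊆ {z | 0 < z.im} := fun z hz => (half_pos hw).trans hz.2
  have h1 := Complex.differentiableOn_tsum_of_summable_norm hu
    (fun v => (differentiableOn_poincareTail (ρ := ρ) (k := k) (r := r) (e := e) v).mono hsub)
    hUo fun v z hz => hle v _ (by
      rw [mem_verticalStrip_iff]
      have h2 : ((ofComplex z : ℍ) : ℂ) = z := ofComplex_apply_of_im_pos (hsub hz) ▸ rfl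
      rw [← coe_re, ← coe_im, h2]
      exact ⟨hz.1.le, hz.2.le⟩)
  have hwU : w ∈ U := ⟨by simp, by linarith⟩
  have h3 := (differentiableWithinAt_pi.mp (h1 w hwU)) ξ
  exact (h3.differentiableAt (hUo.mem_nhds hwU)).differentiableWithinAt

end

section

/-! ### Surjectivity of a principal part map -/

variable {d : ℕ} {ρ : SL(2, ℤ) →* GL (Fin d) ℂ} {Λ : Fin d → ℚ}

theorem twist_T_smul (hΛ : IsExponent ρ Λ) {X : ℍ → Fin d → ℂ} {τ : ℍ}
    (hX : X (ModularGroup.T • τ) = (ρ ModularGroup.T : Matrix (Fin d) (Fin d) ℂ) *ᵥ X τ)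
    (ξ : Fin d) : twist Λ X ξ (ModularGroup.T • τ) = twist Λ X ξ τ := by
  rw [twist, twist, hX, hΛ, Matrix.mulVec_diagonal, UpperHalfPlane.modular_T_smul, qPow_vadd_one,
    mul_neg, Complex.exp_neg]
  have := Complex.exp_ne_zero (2 * π * Complex.I * (Λ ξ : ℂ))
  field_simp

theorem isBoundedAtImInfty_of_verticalStrip {f : ℍ → ℂ}
    (hper : ∀ τ, f (ModularGroup.T • τ) = f τ) {C : ℝ}
    (hC : ∀ τ ∈ verticalStrip 1 1, ‖f τ‖ ≤ C) : IsBoundedAtImInfty f := by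
  have hper' : ∀ (n : ℤ) (τ : ℍ), f (ModularGroup.T ^ n • τ) = f τ := by
    intro n
    induction n using Int.induction_on with
    | zero => simp
    | succ n ih => intro τ; rw [_root_.zpow_add_one, mul_smul, ih, hper]
    | pred n ih =>
      intro τ
      rw [_root_.zpow_sub_one, mul_smul, ih, ← hper, smul_inv_smul]
  rw [isBoundedAtImInfty_iff]
  refine ⟨C, 1, fun τ hτ => ?_⟩
  obtain ⟨n, hn⟩ := ModularGroup_T_zpow_mem_verticalStrip τ one_pos
  rw [← hper' ((1 : ℕ) * n)]
  refine hC _ ?_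
  rw [Nat.cast_one] at hn
  exact verticalStrip_anti_right 1 hτ hn

theorem hasLead_discriminant_inv_pow (m : ℕ) :
    ∃ y, HasLead (ModularForm.discriminant⁻¹ ^ m) (-m) 1 y := by
  induction m with
  | zero =>
    refine ⟨0, Pi.single 0 1, ?_, fun n hn => ?_, by simp, by simp⟩
    · rw [pow_zero]
      exact hasQSeries_const 1
    · exact Pi.single_eq_of_ne (by simpa using hn.ne) _
  | succ m ih =>
    obtain ⟨y, hy⟩ := ih
    refine ⟨1 * 24 + y * 1, ?_⟩
    rw [pow_succ]
    convert hy.mul hasLead_discriminant_inv using 1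
    · push_cast; ring
    · ring

/-- Poincaré series: leading terms of elements of `M(ρ)` can be prescribed. -/
theorem exists_poincare_expansion (hneg : ρ (-1) = 1) (hΛ : IsExponent ρ Λ)
    (hΛ0 : ∀ ξ, Λ ξ ≤ 0) :
    ∃ m : ℕ, ∀ (ξ : Fin d) (n : ℕ+), ∃ (P : ℍ → Fin d → ℂ) (a : Fin d → ℤ → ℂ),
      (∀ (γ : SL(2, ℤ)) (τ : ℍ), P (γ • τ) =
        denom γ τ ^ (12 * m) • ((ρ γ : Matrix (Fin d) (Fin d) ℂ) *ᵥ P τ)) ∧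
      (∀ η, HasQSeries (twist Λ P η) (a η)) ∧ (∀ η, ∀ k < -(n : ℤ), a η k = 0) ∧
      ∀ η, a η (-(n : ℤ)) = if η = ξ then 2 else 0 := by
  obtain ⟨M, K, hM, hgrowth⟩ := exists_norm_mulVec_le_pow hneg hΛ
  -- The weight 12 (K + 1) is divisible by 12, so that a power of Δ can cancel it, and it exceeds K
  -- by 11 K + 12 ≥ 3.
  refine ⟨K + 1, fun ξ n => ?_⟩
  set s : ℝ := (Λ ξ : ℝ) - n with hs
  have hs0 : s ≤ 0 := by
    have : (Λ ξ : ℝ) ≤ 0 := by exact_mod_cast hΛ0 ξ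
    have : (0 : ℝ) ≤ (n : ℕ) := Nat.cast_nonneg _
    linarith
  set e : Fin d → ℂ := Pi.single ξ 1 with he_def
  have hk : Even (12 * (K + 1)) := ⟨6 * (K + 1), by ring⟩
  have he : (ρ ModularGroup.T : Matrix (Fin d) (Fin d) ℂ) *ᵥ e =
      cexp (2 * π * Complex.I * (s : ℂ)) • e := by
    have h1 : cexp (2 * π * Complex.I * (s : ℂ)) = cexp (2 * π * Complex.I * (Λ ξ : ℂ)) := by
      rw [Complex.exp_eq_exp_iff_exists_int]
      refine ⟨-(n : ℤ), ?_⟩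
      rw [hs]
      push_cast
      ring
    rw [hΛ, h1]
    funext η
    rw [Matrix.mulVec_diagonal, Pi.smul_apply, smul_eq_mul]
    by_cases h : η = ξ
    · rw [h]
    · rw [he_def, Pi.single_eq_of_ne h, mul_zero, mul_zero]
  have hbound : ∀ (A : ℝ) {B : ℝ}, 0 < B → ∃ u : CoprimePair → ℝ, Summable u ∧
      ∀ v, ∀ τ ∈ verticalStrip A B, ‖poincareTail ρ (12 * (K + 1)) s e v τ‖ ≤ u v := by
    intro A B hB
    have := exists_norm_poincareTail_le hM hgrowth (j := 11 * K + 12) (by lia) s hs0 e A hB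
    rwa [show K + (11 * K + 12) = 12 * (K + 1) by ring] at this
  have hsum : ∀ τ, Summable fun v => poincareTail ρ (12 * (K + 1)) s e v τ := fun τ => by
    obtain ⟨u, hu, hle⟩ := hbound |τ.re| τ.im_pos
    exact Summable.of_norm_bounded hu fun v => hle v τ ⟨le_rfl, le_rfl⟩
  set P := poincare ρ (12 * (K + 1)) s e with hP
  set Q : ℍ → Fin d → ℂ := fun τ => ∑' v, poincareTail ρ (12 * (K + 1)) s e v τ with hQ
  have hPQ : ∀ τ, P τ = (2 : ℂ) • qPow s τ • e + Q τ := fun τ =>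
    (poincare_eq hneg hk he (hsum τ)).2
  have hmod : ∀ (γ : SL(2, ℤ)) (τ : ℍ), P (γ • τ) =
      denom γ τ ^ (12 * (K + 1)) • ((ρ γ : Matrix (Fin d) (Fin d) ℂ) *ᵥ P τ) :=
    poincare_smul hneg hk he fun τ => (poincare_eq hneg hk he (hsum τ)).1
  have hPT : ∀ τ, P (ModularGroup.T • τ) =
      (ρ ModularGroup.T : Matrix (Fin d) (Fin d) ℂ) *ᵥ P τ := fun τ => by
    rw [hmod, ModularGroup.denom_apply]
    simp [ModularGroup.T]
  have hQT : ∀ τ, Q (ModularGroup.T • τ) =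
      (ρ ModularGroup.T : Matrix (Fin d) (Fin d) ℂ) *ᵥ Q τ := fun τ => by
    have h1 : ∀ τ, Q τ = P τ - (2 : ℂ) • qPow s τ • e := fun τ => by rw [hPQ, add_sub_cancel_left]
    rw [h1, h1, hPT, UpperHalfPlane.modular_T_smul, qPow_vadd_one, Matrix.mulVec_sub,
      Matrix.mulVec_smul, Matrix.mulVec_smul, he, smul_smul (qPow _ _), mul_comm (qPow _ _)]
  have hQS : ∀ η, ∃ a : ℤ → ℂ, HasQSeries (twist Λ Q η) a ∧ ∀ k < 0, a k = 0 := fun η => by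
    refine hasQSeries_of_isBoundedAtImInfty ?_ (fun τ => ?_) ?_
    · exact (mdifferentiable_qPow _).mul (mdifferentiable_tsum_poincareTail hbound η)
    · rw [← UpperHalfPlane.modular_T_smul, twist_T_smul hΛ (hQT τ)]
    · obtain ⟨u, hu, hle⟩ := hbound 1 one_pos
      refine isBoundedAtImInfty_of_verticalStrip (C := ∑' v, u v)
        (fun τ => twist_T_smul hΛ (hQT τ) η) fun τ hτ => ?_
      have h1 : ‖Q τ‖ ≤ ∑' v, u v := tsum_of_norm_bounded hu.hasSum fun v => hle v τ hτ
      -- Here Λ ≤ 0 matters: twisting keeps the tail bounded at the cusp, so it contributes no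
      -- negative powers of q.
      have h2 : ‖qPow (-(Λ η : ℂ)) τ‖ ≤ 1 := by
        have := norm_qPow (-(Λ η : ℝ)) τ
        push_cast at this
        rw [this, Real.exp_le_one_iff]
        have h3 : (Λ η : ℝ) ≤ 0 := by exact_mod_cast hΛ0 η
        have h4 : 0 ≤ 2 * π * (-(Λ η : ℝ)) * τ.im :=
          mul_nonneg (mul_nonneg (by positivity) (by linarith)) τ.im_pos.le
        linarith
      rw [twist, norm_mul]
      exact (mul_le_of_le_one_left (norm_nonneg _) h2).trans ((norm_le_pi_norm _ η).trans h1)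
  choose b hb hb0 using hQS
  refine ⟨P, fun η => (fun k => (Pi.single 0 (2 * e η) : ℤ → ℂ) (k - -(n : ℤ))) + b η, hmod,
    fun η => ?_, fun η k hk => ?_, fun η => ?_⟩
  · have h1 := ((hasQSeries_const (2 * e η)).qPow_mul (-(n : ℤ))).add (hb η)
    convert h1 using 1
    funext τ
    simp only [twist, hPQ, Pi.add_apply, Pi.smul_apply, smul_eq_mul]
    by_cases h : η = ξ
    · subst h
      have h2 : qPow (((-(n : ℤ) : ℤ)) : ℂ) τ = qPow (-(Λ η : ℂ)) τ * qPow s τ := by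
        rw [← qPow_add, hs]
        congr 1
        push_cast
        ring
      rw [h2]
      ring
    · rw [he_def, Pi.single_eq_of_ne h]
      ring
  · have := n.pos
    change (Pi.single 0 (2 * e η) : ℤ → ℂ) (k - -(n : ℤ)) + b η k = 0
    rw [hb0 η k (by lia), Pi.single_eq_of_ne (by lia), add_zero]
  · have := n.pos
    change (Pi.single 0 (2 * e η) : ℤ → ℂ) (-(n : ℤ) - -(n : ℤ)) + b η (-(n : ℤ)) = _
    rw [hb0 η _ (by lia), sub_self, Pi.single_eq_same, add_zero, he_def,
      Pi.single_apply]
    split_ifs <;> simp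

theorem exists_vecCoeff_eq_single (hneg : ρ (-1) = 1) (hΛ : IsExponent ρ Λ) :
    ∃ Λ', IsExponent ρ Λ' ∧ ∀ (ξ : Fin d) (n : ℕ+), ∃ X ∈ modFun ρ,
      (∀ k < -(n : ℤ), vecCoeff Λ' X k = 0) ∧
      vecCoeff Λ' X (-(n : ℤ)) = (2 : ℂ) • (Pi.single ξ 1 : Fin d → ℂ) := by
  set Λ₀ : Fin d → ℚ := fun ξ => Λ ξ + (-⌈Λ ξ⌉ : ℤ) with hΛ₀_def
  have hΛ₀ : IsExponent ρ Λ₀ := hΛ.add_int fun ξ => rfl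
  have hle : ∀ ξ, Λ₀ ξ ≤ 0 := fun ξ => by
    have := Int.le_ceil (Λ ξ)
    simp only [hΛ₀_def]
    push_cast
    linarith
  obtain ⟨m, hm⟩ := exists_poincare_expansion hneg hΛ₀ hle
  -- Lowering the exponent by m absorbs the pole of order m of Δ^(-m), so the order of the leading
  -- term is still -n.
  set Λ' : Fin d → ℚ := fun ξ => Λ₀ ξ + (-(m : ℤ) : ℤ) with hΛ'_def
  have hΛ' : IsExponent ρ Λ' := hΛ₀.add_int fun ξ => rfl
  refine ⟨Λ', hΛ', fun ξ n => ?_⟩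
  obtain ⟨P, a, hmod, ha, ha0, ha1⟩ := hm ξ n
  obtain ⟨y, c, hc, hc0, hc1, -⟩ := hasLead_discriminant_inv_pow m
  have hc' := hc.qPow_mul m
  have hser : ∀ η, HasQSeries (twist Λ' (ModularForm.discriminant⁻¹ ^ m • P) η)
      (fun k => ∑ j ∈ Finset.Icc 0 (k - -(n : ℤ)), c (j - m) * a η (k - j)) := fun η => by
    have h1 := hc'.mul (ha η) (M := 0) (fun j hj => hc0 _ (by lia)) (ha0 η)
    convert h1 using 1
    funext τ
    have h2 : qPow (-(Λ' η : ℂ)) τ = qPow (m : ℤ) τ * qPow (-(Λ₀ η : ℂ)) τ := by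
      rw [← qPow_add, hΛ'_def]
      congr 1
      push_cast
      ring
    simp only [twist, Pi.mul_apply, Pi.smul_apply', Pi.smul_apply, smul_eq_mul, h2]
    ring
  refine ⟨_, mem_modFun_of_hasQSeries (N := -(n : ℤ)) hΛ' (fun γ τ => ?_) hser fun η k hk => ?_,
    fun k hk => ?_, ?_⟩
  · have h1 := denom_ne_zero (γ : GL (Fin 2) ℝ) τ
    simp only [Pi.smul_apply', Pi.pow_apply, Pi.inv_apply]
    rw [hmod, discriminant_smul, Matrix.mulVec_smul, smul_smul, _root_.mul_inv, mul_pow,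
      pow_mul, inv_pow, mul_right_comm, inv_mul_cancel₀ (pow_ne_zero _ (pow_ne_zero _ h1)),
      one_mul]
  · rw [Finset.Icc_eq_empty (by lia), Finset.sum_empty]
  · funext η
    rw [vecCoeff_eq (hser η), Finset.Icc_eq_empty (by lia), Finset.sum_empty, Pi.zero_apply]
  · funext η
    rw [vecCoeff_eq (hser η), sub_self, Finset.Icc_self, Finset.sum_singleton, sub_zero, ha1,
      zero_sub, hc1, one_mul, Pi.smul_apply, Pi.single_apply]
    split_ifs <;> simp

theorem surjective_principalPart_of_vecCoeff_eq_single (hΛ : IsExponent ρ Λ)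
    (h : ∀ (ξ : Fin d) (n : ℕ+), ∃ X ∈ modFun ρ, (∀ k < -(n : ℤ), vecCoeff Λ X k = 0) ∧
      vecCoeff Λ X (-(n : ℤ)) = (2 : ℂ) • (Pi.single ξ 1 : Fin d → ℂ)) :
    Function.Surjective (principalPart ρ Λ hΛ) := by
  rw [← LinearMap.range_eq_top]
  have key : ∀ (n : ℕ+) (v : Fin d → ℂ),
      Finsupp.single n v ∈ LinearMap.range (principalPart ρ Λ hΛ) := by
    intro n
    induction n using PNat.strongInductionOn with
    | _ n ih =>
      have hξ : ∀ ξ, Finsupp.single n (Pi.single ξ 1 : Fin d → ℂ) ∈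
          LinearMap.range (principalPart ρ Λ hΛ) := by
        intro ξ
        obtain ⟨X, hX, hX0, hX1⟩ := h ξ n
        -- The lower polar coefficients of X are uncontrolled, but they lie in the range by
        -- induction on the order of the pole.
        have h1 : Finsupp.single n ((2 : ℂ) • (Pi.single ξ 1 : Fin d → ℂ)) =
            principalPart ρ Λ hΛ ⟨X, hX⟩ - ∑ m ∈ Finset.Ico 1 n,
              Finsupp.single m (vecCoeff Λ X (-(m : ℤ))) := by
          ext1 k
          rw [Finsupp.sub_apply, Finsupp.finsetSum_apply, principalPart_apply]
          simp only [Finsupp.single_apply]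
          rw [Finset.sum_ite_eq']
          rcases lt_trichotomy k n with hk | rfl | hk
          · rw [if_neg hk.ne', if_pos (Finset.mem_Ico.mpr ⟨one_le, hk⟩), sub_self]
          · rw [if_pos rfl, if_neg (by simp), sub_zero, hX1]
          · rw [if_neg hk.ne, if_neg (by simp [hk.le]), sub_zero, hX0 _ ?_]
            have : (n : ℕ) < k := hk
            lia
        have h2 : Finsupp.single n ((2 : ℂ) • (Pi.single ξ 1 : Fin d → ℂ)) ∈
            LinearMap.range (principalPart ρ Λ hΛ) := by
          rw [h1]
          exact sub_mem ⟨_, rfl⟩ (sum_mem fun m hm => ih m (Finset.mem_Ico.mp hm).2 _)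
        have h3 := (LinearMap.range (principalPart ρ Λ hΛ)).smul_mem (2⁻¹ : ℂ) h2
        rwa [Finsupp.smul_single, smul_smul, inv_mul_cancel₀ two_ne_zero, one_smul] at h3
      intro v
      have h4 : Finsupp.single n v = ∑ ξ, v ξ • Finsupp.single n (Pi.single ξ 1 : Fin d → ℂ) := by
        conv_lhs => rw [pi_eq_sum_univ' v]
        rw [← Finsupp.lsingle_apply (R := ℂ), map_sum]
        refine Finset.sum_congr rfl fun ξ _ => ?_
        simp
      rw [h4]
      exact sum_mem fun ξ _ => Submodule.smul_mem _ _ (hξ ξ)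
  rw [eq_top_iff]
  intro f _
  induction f using Finsupp.induction_linear with
  | zero => exact zero_mem _
  | add f g hf hg => exact add_mem (hf trivial) (hg trivial)
  | single n v => exact key n v

theorem exists_surjective_principalPart (hneg : ρ (-1) = 1) (hΛ : IsExponent ρ Λ) :
    ∃ (Λ' : Fin d → ℚ) (hΛ' : IsExponent ρ Λ'), Function.Surjective (principalPart ρ Λ' hΛ') := by
  obtain ⟨Λ', hΛ', h⟩ := exists_vecCoeff_eq_single hneg hΛ
  exact ⟨Λ', hΛ', surjective_principalPart_of_vecCoeff_eq_single hΛ' h⟩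

end

end VVMF

end

/-! ### Assembly of the theorem. -/

theorem mainTheorem1 {d : ℕ} (ρ : SL(2, ℤ) →* GL (Fin d) ℂ) (hneg : ρ (-1) = 1)
    (hdiag : (ρ ModularGroup.T : Matrix (Fin d) (Fin d) ℂ).IsDiag)
    (hfin : IsOfFinOrder (ρ ModularGroup.T)) :
    (∃ N : Submodule VVMF.CJ (ℍ → Fin d → ℂ),
      N.restrictScalars ℂ = VVMF.modFun ρ ∧
      Module.Free VVMF.CJ N ∧ Module.rank VVMF.CJ N = d) ∧
    (∃ (Λ : Fin d → ℚ) (hΛ : VVMF.IsExponent ρ Λ),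
      Function.Bijective (VVMF.principalPart ρ Λ hΛ)) ∧
    (∀ (Λ : Fin d → ℚ) (hΛ : VVMF.IsExponent ρ Λ),
      Function.Bijective (VVMF.principalPart ρ Λ hΛ) →
      ∃ B : Fin d → ℕ+ → VVMF.modFun ρ,
        VVMF.IsCanonicalBasis hΛ B ∧
        (∀ B', VVMF.IsCanonicalBasis hΛ B' → B' = B) ∧
        LinearIndependent ℂ (fun p : Fin d × ℕ+ => B p.1 p.2) ∧
        Submodule.span ℂ (Set.range fun p : Fin d × ℕ+ => B p.1 p.2) = ⊤ ∧
        (∀ (ξ : Fin d) (m : ℕ+) (τ : ℍ),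
          (B ξ (m + 1) : ℍ → Fin d → ℂ) τ =
            VVMF.hauptmodul τ • (B ξ m : ℍ → Fin d → ℂ) τ
            - ∑ n ∈ Finset.Ico 1 m, VVMF.jCoeff n • (B ξ (m - n) : ℍ → Fin d → ℂ) τ
            - ∑ η, VVMF.vecCoeff Λ (B ξ m) 0 η • (B η 1 : ℍ → Fin d → ℂ) τ) ∧
        LinearIndependent VVMF.CJ (fun η τ ξ => VVMF.fundamentalMatrix B τ ξ η) ∧
        (Submodule.span VVMF.CJ
          (Set.range fun η τ ξ => VVMF.fundamentalMatrix B τ ξ η)).restrictScalars ℂ =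
            VVMF.modFun ρ ∧
        (∃ τ, (VVMF.fundamentalMatrix B τ).det ≠ 0) ∧
        (∀ τ, VVMF.calE τ • VVMF.qDeriv (VVMF.fundamentalMatrix B) τ =
          VVMF.fundamentalMatrix B τ *
            VVMF.compatNumerator Λ (VVMF.characteristicMatrix Λ B) τ) ∧
        (∀ τ, VVMF.calE τ ≠ 0 →
          VVMF.qDeriv (VVMF.fundamentalMatrix B) τ =
            VVMF.fundamentalMatrix B τ * VVMF.compatD Λ (VVMF.characteristicMatrix Λ B) τ) ∧
        (∀ ξ η, (fun τ => VVMF.qPow (1 - (Λ ξ : ℂ)) τ * VVMF.fundamentalMatrix B τ ξ η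
            - (if ξ = η then 1 else 0)) =O[atImInfty] VVMF.qPow 1) ∧
        (∀ (γ : SL(2, ℤ)) (τ : ℍ), VVMF.fundamentalMatrix B (γ • τ) =
          (ρ γ : Matrix (Fin d) (Fin d) ℂ) * VVMF.fundamentalMatrix B τ)) := by
  obtain ⟨Λ, hΛ⟩ := VVMF.exists_isExponent ρ hdiag hfin
  obtain ⟨Λ₁, hΛ₁, h₁⟩ := VVMF.exists_surjective_principalPart hneg hΛ
  -- Surjectivity for the contragredient serves only to make the kernels for ρ finite dimensional.
  obtain ⟨Λ₂, hΛ₂, h₂⟩ :=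
    VVMF.exists_surjective_principalPart (VVMF.dualRep_neg_one hneg) hΛ.dualRep
  obtain ⟨Λ₀, hΛ₀, hb₀⟩ := VVMF.exists_bijective_principalPart hΛ₁ hΛ₂ h₁ h₂
  refine ⟨VVMF.exists_free_adjoin hΛ₀ hb₀, ⟨Λ₀, hΛ₀, hb₀⟩, fun Λ hΛ hb => ?_⟩
  have hB := VVMF.isCanonicalBasis_canonicalBasis hΛ hb
  refine ⟨_, hB, fun B' hB' => ?_, (hB.span_eq_top hb).1, (hB.span_eq_top hb).2,
    fun ξ m τ => ?_, hB.linearIndependent_adjoin, hB.span_adjoin_eq hb, hB.exists_det_ne_zero,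
    hB.calE_smul_qDeriv hb.1, fun τ => hB.qDeriv_eq hb.1, hB.isBigO_fundamentalMatrix,
    VVMF.fundamentalMatrix_smul⟩
  · funext ξ n
    exact hb.1 ((hB' ξ n).trans (hB ξ n).symm)
  · have h := congrFun (congrArg (Subtype.val : VVMF.modFun ρ → ℍ → Fin d → ℂ)
      (hB.recurrence hb.1 ξ m)) τ
    refine h.trans ?_
    push_cast
    simp only [Pi.sub_apply, Pi.smul_apply', Pi.smul_apply, Finset.sum_apply]
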